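/- Let $n\ge 1$ and $a,b>0$. For integrable $f:\mathbb R^n\to\mathbb C$ put $\hat f(\xi)=(2\pi)^{-n/2}\int_{\mathbb R^n} f(x)e^{-ix\cdot\xi}\,dx$, and for $z\in\mathbb C^n$ write $z^2=z_1^2+\dots+z_n^2$. Say that $f$ satisfies condition $(\ast)$ with functions $P,Q:\mathbb R^n\to\mathbb R$ if $f$ is integrable, $$|f(x)|\le P(x)e^{-\frac12 a|x|^2},\qquad |\hat f(\xi)|\le Q(\xi)e^{-\frac12 b|\xi|^2}\qquad(x,\xi\in\mathbb R^n),$$ and $$\limsup_{|x|\to\infty}\frac{\log P(x)}{|x|^2}=0=\limsup_{|\xi|\to\infty}\frac{\log Q(\xi)}{|\xi|^2}$$ (with $\log 0=-\infty$). (i) If $ab>1$ and $f$ satisfies $(\ast)$ with some $P,Q$, then $f=0$ almost everywhere. (ii) If $ab=1$ and $f$ satisfies $(\ast)$ with some $P,Q$, then $f$ (after modification on a null set) and $\hat f$ extend to entire functions on $\mathbb C^n$ of the form $$f(z)=R(z)e^{-\frac12 a z^2},\qquad \hat f(z)=S(z)e^{-\frac1{2a}z^2},$$ where $R$ and $S$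 are entire functions on $\mathbb C^n$ of order at most $2$ and at most of minimal type with respect to the order $2$; that is, $\limsup_{r\to\infty} r^{-2}\log\max_{|z|\le r}|F(z)|\le 0$ for $F=R$ and for $F=S$. (iii) If $ab<1$, there are $P,Q$ and infinitely many linearly independent continuous functions that satisfy $(\ast)$ with these $P,Q$. Moreover, for every $c>0$ with $a\le c^2\le 1/b$ and every multi-index $\alpha\in\mathbb N^n$, the dilated Hermite function $x\mapsto\Phi_\alpha(cx)$ satisfies $(\ast)$ with some $P,Q$ (depending on $\alpha$ and $c$). Here $\Phi_\alpha(x)=\prod_{j=1}^n h_{\alpha_j}(x_j)$ and $h_k(t)=(2^kk!\sqrt\pi)^{-1/2}(-1)^ke^{t^2/2}\frac{d^k}{dt^k}e^{-t^2}$. -/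

import Mathlib

open MeasureTheory Filter
open scoped ENNReal

namespace Pfannschmidt

/-- The unitary Fourier transform on `ℝⁿ`,
`f̂(ξ) = (2π)^(-n/2) ∫ f(x) exp(-i x·ξ) dx`, used for integrable `f`. -/
noncomputable def fourier {n : ℕ} (f : EuclideanSpace ℝ (Fin n) → ℂ)
    (ξ : EuclideanSpace ℝ (Fin n)) : ℂ :=
  (((2 * Real.pi) ^ (-(n : ℝ) / 2) : ℝ) : ℂ) *
    ∫ x, Complex.exp (-Complex.I * ((inner ℝ x ξ : ℝ) : ℂ)) * f x

/-- `limsup_{|x| → ∞} log P(x) / |x|²`, as an extended real number, with `log 0 = -∞`. -/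
noncomputable def logGrowth {n : ℕ} (P : EuclideanSpace ℝ (Fin n) → ℝ) : EReal :=
  limsup (fun x => ENNReal.log (ENNReal.ofReal (P x)) / ((‖x‖ ^ 2 : ℝ) : EReal))
    (Bornology.cobounded (EuclideanSpace ℝ (Fin n)))

/-- The decay condition on `f` and `f̂`.  Integrability is what gives `f̂` its meaning: the
bound by `P` controls `f` only near infinity, since `P` need not be locally bounded. -/
structure Condition {n : ℕ} (a b : ℝ) (P Q : EuclideanSpace ℝ (Fin n) → ℝ)
    (f : EuclideanSpace ℝ (Fin n) → ℂ) : Prop where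
  integrable : Integrable f
  bound : ∀ x, ‖f x‖ ≤ P x * Real.exp (-(a * ‖x‖ ^ 2 / 2))
  bound_fourier : ∀ ξ, ‖fourier f ξ‖ ≤ Q ξ * Real.exp (-(b * ‖ξ‖ ^ 2 / 2))
  logGrowth_left : logGrowth P = 0
  logGrowth_right : logGrowth Q = 0

/-- The inclusion `ℝⁿ ⊆ ℂⁿ`. -/
noncomputable def toComplex {n : ℕ} (x : EuclideanSpace ℝ (Fin n)) :
    EuclideanSpace ℂ (Fin n) :=
  WithLp.toLp 2 fun j => (x j : ℂ)

/-- `z² = z₁² + ⋯ + zₙ²` for `z ∈ ℂⁿ`. -/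
noncomputable def sq {n : ℕ} (z : EuclideanSpace ℂ (Fin n)) : ℂ := ∑ j, z j ^ 2

/-- The maximum modulus `M(r) = sup_{|z| ≤ r} |F(z)|`. -/
noncomputable def maxModulus {n : ℕ} (F : EuclideanSpace ℂ (Fin n) → ℂ) (r : ℝ) : ℝ≥0∞ :=
  ⨆ z ∈ Metric.closedBall (0 : EuclideanSpace ℂ (Fin n)) r, ‖F z‖ₑ

/-- The type of `F` with respect to the order `ρ`: `limsup_{r → ∞} log M(r) / r^ρ`. -/
noncomputable def growthType {n : ℕ} (ρ : ℝ) (F : EuclideanSpace ℂ (Fin n) → ℂ) : EReal :=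
  limsup (fun r : ℝ => ENNReal.log (maxModulus F r) / ((r ^ ρ : ℝ) : EReal)) atTop

/-- The order of `F`: the infimum of the `ρ ≥ 0` such that `log M(r) ≤ C r^ρ` for some `C`
and all large `r`. -/
noncomputable def growthOrder {n : ℕ} (F : EuclideanSpace ℂ (Fin n) → ℂ) : EReal :=
  ⨅ (ρ : ℝ) (_ : 0 ≤ ρ) (_ : growthType ρ F < ⊤), (ρ : EReal)

/-- `F` is an entire function on `ℂⁿ` of order (at most) `2` and at most of minimal type, that
is, of type zero with respect to the order `2`. -/
structure IsEntireMinimalType {n : ℕ} (F : EuclideanSpace ℂ (Fin n) → ℂ) : Prop where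
  entire : Differentiable ℂ F
  order_le : growthOrder F ≤ 2
  type_le : growthType 2 F ≤ 0

/-- The normalized Hermite function
`h_k(t) = (2^k k! √π)^(-1/2) (-1)^k e^(t²/2) (d/dt)^k e^(-t²)` on `ℝ`. -/
noncomputable def hermite1 (k : ℕ) (t : ℝ) : ℝ :=
  (Real.sqrt (2 ^ k * (k.factorial : ℝ) * Real.sqrt Real.pi))⁻¹ * (-1) ^ k *
    Real.exp (t ^ 2 / 2) * iteratedDeriv k (fun s : ℝ => Real.exp (-s ^ 2)) t

/-- The Hermite functions `Φ_α(x) = ∏ⱼ h_{αⱼ}(xⱼ)` on `ℝⁿ`. -/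
noncomputable def hermiteFun {n : ℕ} (α : Fin n → ℕ) (x : EuclideanSpace ℝ (Fin n)) : ℂ :=
  ((∏ j, hermite1 (α j) (x j) : ℝ) : ℂ)

end Pfannschmidt

/-
The functions `P` and `Q` only cost factors `exp (ε |x|²)`, so `f` and `f̂` decay like Gaussians of
every rate below `a` and `b`. Hence `f̂` extends to an entire function on `ℂⁿ`, and for real `y` the
extension at `w y` is bounded by a multiple of `exp (|y|² (Im w)² / (2 a'))` whenever `a' < a`. On
the line `w ↦ w y` consider `k w = f̂ (w y) exp (m |y|² w² / 2)`.

* If `ab > 1`, choose `1 / a < m < b`. Then `k` is bounded by a multiple of `exp (K (Re w)²)`, and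
  it decays on the real axis. By Phragmén–Lindelöf in narrowing sectors around the imaginary axis
  it is bounded, so it is constant by Liouville, and the constant is `0`.
* If `ab = 1`, choose `m = b`. The same argument, with both exponents perturbed by `O(t²)` and
  sectors of half-angle about `t` around the imaginary axis, bounds `k` by `C exp (O(t) |y|² |w|²)`.
  The maximum principle on the discs `p ↦ ζ + p ζ̄`, whose boundary points are complex multiples of
  real vectors, transfers this bound to all of `ℂⁿ`. Fourier inversion exchanges `f` and `f̂`.
* If `ab < 1`, the Gaussians `exp (-c |x|² / 2)` with `a < c < 1 / b` are linearly independent. The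
  Hermite functions are eigenfunctions of the Fourier transform because the raising operator
  `d/dt - t` commutes with it up to the factor `-i`.
-/

namespace Pfannschmidt

/-! ### Phragmén–Lindelöf estimates of order two -/

section PhragmenLindelof

variable {E : Type*} [NormedAddCommGroup E] [NormedSpace ℂ E]

theorem norm_le_of_sector {k : ℂ → E} (hk : Differentiable ℂ k) {ψ : ℝ} (hψ₀ : 0 < ψ)
    (hψ : ψ < Real.pi / 2) {B C D : ℝ}
    (hgrowth : ∀ w, ‖k w‖ ≤ D * Real.exp (B * ‖w‖ ^ 2))
    (h₀ : ∀ r : ℝ, 0 < r → ‖k r‖ ≤ C)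
    (h₁ : ∀ r : ℝ, 0 < r → ‖k (r * Complex.exp (ψ * Complex.I))‖ ≤ C)
    {r φ : ℝ} (hr : 0 < r) (hφ₀ : 0 ≤ φ) (hφ : φ ≤ ψ) :
    ‖k (r * Complex.exp (φ * Complex.I))‖ ≤ C := by
  have polar (ζ : ℂ) : Complex.exp ζ = (Real.exp ζ.re : ℝ) * Complex.exp (ζ.im * Complex.I) := by
    rw [Complex.ofReal_exp, ← Complex.exp_add, Complex.re_add_im]
  have order_lt : ∃ c < Real.pi / (ψ - 0), ∃ B', (fun ζ => k (Complex.exp ζ))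
      =O[comap (|Complex.re ·|) atTop ⊓ 𝓟 (Complex.im ⁻¹' Set.Ioo 0 ψ)]
        fun ζ => Real.exp (B' * Real.exp (c * |ζ.re|)) := by
    refine ⟨2, ?_, |B|, .of_bound |D| (.of_forall fun ζ => ?_)⟩
    · rw [sub_zero, lt_div_iff₀ hψ₀]
      linarith
    · have hsq : ‖Complex.exp ζ‖ ^ 2 ≤ Real.exp (2 * |ζ.re|) := by
        rw [Complex.norm_exp, ← Real.exp_nat_mul]
        push_cast
        gcongr
        exact le_abs_self _
      rw [Real.norm_of_nonneg (Real.exp_pos _).le]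
      refine (hgrowth _).trans ?_
      gcongr <;> exact le_abs_self _
  have bound_strip := PhragmenLindelof.horizontal_strip (f := fun ζ => k (Complex.exp ζ))
    (z := (Real.log r : ℂ) + φ * Complex.I) (hk.comp Complex.differentiable_exp).diffContOnCl
    order_lt
    (fun ζ hζ => by simpa [polar ζ, hζ] using h₀ _ (Real.exp_pos ζ.re))
    (fun ζ hζ => by simpa only [polar ζ, hζ] using h₁ _ (Real.exp_pos ζ.re))
    (by simpa) (by simpa)
  simpa [Complex.exp_add, ← Complex.ofReal_exp, Real.exp_log hr] using bound_strip

theorem norm_cexp_neg_mul_polar_sq (A r θ ψ : ℝ) :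
    ‖Complex.exp (-(A * (r * Complex.exp (θ * Complex.I)) ^ 2 *
      Complex.exp (-(ψ * Complex.I))))‖ = Real.exp (-(A * Real.cos (2 * θ - ψ) * r ^ 2)) := by
  have hpolar : -((A : ℂ) * (r * Complex.exp (θ * Complex.I)) ^ 2 *
      Complex.exp (-(ψ * Complex.I))) =
      ((-(A * r ^ 2) : ℝ) : ℂ) * Complex.exp (((2 * θ - ψ : ℝ) : ℂ) * Complex.I) := by
    have hangle : ((2 * θ - ψ : ℝ) : ℂ) * Complex.I =
        (2 : ℕ) * (θ * Complex.I) + -(ψ * Complex.I) := by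
      push_cast
      ring
    rw [hangle, Complex.exp_add, Complex.exp_nat_mul]
    push_cast
    ring
  rw [Complex.norm_exp, hpolar, Complex.re_ofReal_mul, Complex.exp_ofReal_mul_I_re]
  congr 1
  ring

theorem norm_le_exp_of_sector {k : ℂ → E} (hk : Differentiable ℂ k) {ψ : ℝ} (hψ₀ : 0 < ψ)
    (hψ : ψ < Real.pi / 2) {A B C D : ℝ}
    (hgrowth : ∀ w, ‖k w‖ ≤ D * Real.exp (B * ‖w‖ ^ 2))
    (h₀ : ∀ r : ℝ, 0 < r → ‖k r‖ ≤ C * Real.exp (A * Real.cos ψ * r ^ 2))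
    (h₁ : ∀ r : ℝ, 0 < r →
      ‖k (r * Complex.exp (ψ * Complex.I))‖ ≤ C * Real.exp (A * Real.cos ψ * r ^ 2))
    {r φ : ℝ} (hr : 0 < r) (hφ₀ : 0 ≤ φ) (hφ : φ ≤ ψ) :
    ‖k (r * Complex.exp (φ * Complex.I))‖ ≤ C * Real.exp (A * Real.cos (2 * φ - ψ) * r ^ 2) := by
  -- dividing by `exp (A e^{-iψ} w²)` makes the boundary values bounded
  let q : ℂ → ℂ := fun w => Complex.exp (-(A * w ^ 2 * Complex.exp (-(ψ * Complex.I))))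
  have hq : Differentiable ℂ q := by fun_prop
  have norm_q (r θ : ℝ) : ‖q (r * Complex.exp (θ * Complex.I))‖ =
      Real.exp (-(A * Real.cos (2 * θ - ψ) * r ^ 2)) := norm_cexp_neg_mul_polar_sq A r θ ψ
  have div_bound {r θ C' : ℝ} :
      ‖q (r * Complex.exp (θ * Complex.I)) • k (r * Complex.exp (θ * Complex.I))‖ ≤ C' ↔
        ‖k (r * Complex.exp (θ * Complex.I))‖ ≤
          C' * Real.exp (A * Real.cos (2 * θ - ψ) * r ^ 2) := by
    rw [norm_smul, norm_q, Real.exp_neg, inv_mul_le_iff₀ (Real.exp_pos _), mul_comm (Real.exp _)]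
  refine div_bound.1 (norm_le_of_sector (hq.smul hk) hψ₀ hψ (B := |A| + B) (D := D)
    (fun w => ?_) (fun r hr => ?_) (fun r hr => div_bound.2 ?_) hr hφ₀ hφ)
  · have norm_q_le : ‖q w‖ ≤ Real.exp (|A| * ‖w‖ ^ 2) := by
      refine (Complex.norm_exp_le_exp_norm _).trans_eq ?_
      rw [norm_neg, norm_mul, norm_mul, norm_pow, Complex.norm_real, Real.norm_eq_abs,
        ← neg_mul, ← Complex.ofReal_neg, Complex.norm_exp_ofReal_mul_I, mul_one]
    rw [Pi.smul_apply', norm_smul, add_mul, Real.exp_add, mul_left_comm]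
    exact mul_le_mul norm_q_le (hgrowth w) (norm_nonneg _) (Real.exp_pos _).le
  · simpa using (div_bound (θ := 0)).2 (by simpa using h₀ r hr)
  · simpa [two_mul] using h₁ r hr

theorem re_sq_add_im_sq_le {K t : ℝ} (hK : 0 ≤ K) {w : ℂ} (hw : w.re ^ 2 ≤ t ^ 2 * ‖w‖ ^ 2) :
    K * w.re ^ 2 + K * t ^ 2 * w.im ^ 2 ≤ 2 * K * t * t * ‖w‖ ^ 2 := by
  have him : w.im ^ 2 ≤ ‖w‖ ^ 2 := by
    rw [Complex.sq_norm, Complex.normSq_apply]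
    nlinarith only [sq_nonneg w.re]
  calc K * w.re ^ 2 + K * t ^ 2 * w.im ^ 2
      ≤ K * (t ^ 2 * ‖w‖ ^ 2) + K * t ^ 2 * ‖w‖ ^ 2 := by gcongr
    _ = 2 * K * t * t * ‖w‖ ^ 2 := by ring

theorem norm_le_exp_of_first_quadrant {K t C : ℝ} (hK : 0 ≤ K) (ht₀ : 0 < t) (ht₁ : t < 1)
    {k : ℂ → E} (hk : Differentiable ℂ k)
    (hgrowth : ∀ w : ℂ, ‖k w‖ ≤ C * Real.exp (K * w.re ^ 2 + K * t ^ 2 * w.im ^ 2))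
    (hreal : ∀ u : ℝ, ‖k u‖ ≤ C * Real.exp (K * t ^ 2 * u ^ 2))
    {w : ℂ} (hre : 0 ≤ w.re) (him : 0 ≤ w.im) :
    ‖k w‖ ≤ C * Real.exp (2 * K * t * ‖w‖ ^ 2) := by
  have hC : 0 ≤ C := by simpa using (norm_nonneg _).trans (hreal 0)
  have growth_le {w : ℂ} (hw : w.re ^ 2 ≤ t ^ 2 * ‖w‖ ^ 2) :
      ‖k w‖ ≤ C * Real.exp (2 * K * t * t * ‖w‖ ^ 2) :=
    (hgrowth w).trans (by gcongr; exact re_sq_add_im_sq_le hK hw)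
  -- Above the ray of angle `arccos t` the majorant is small; below it, use the sector estimate.
  have hcos : Real.cos (Real.arccos t) = t := Real.cos_arccos (by linarith) ht₁.le
  rcases eq_or_ne w 0 with rfl | hw
  · simpa using hreal 0
  rcases le_or_gt w.arg (Real.arccos t) with hle | hgt
  · have hsector := norm_le_exp_of_sector hk (Real.arccos_pos.2 ht₁)
      (Real.arccos_lt_pi_div_two.2 ht₀) (A := 2 * K * t) (B := K + K * t ^ 2) (C := C) (D := C)
      (fun w => (hgrowth w).trans ?_) (fun r _ => (hreal r).trans ?_) (fun r _ => ?_)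
      (norm_pos_iff.2 hw) (Complex.arg_nonneg_iff.2 him) hle
    · rw [Complex.norm_mul_exp_arg_mul_I] at hsector
      refine hsector.trans ?_
      gcongr C * Real.exp (?_ * _)
      exact mul_le_of_le_one_right (by positivity) (Real.cos_le_one _)
    · rw [Complex.sq_norm, Complex.normSq_apply]
      gcongr
      nlinarith only [mul_nonneg hK (sq_nonneg w.im), mul_nonneg hK (sq_nonneg (t * w.re))]
    · rw [hcos]
      gcongr C * Real.exp ?_
      nlinarith only [mul_nonneg hK (sq_nonneg (t * r))]
    · rw [hcos]
      refine (growth_le ?_).trans_eq ?_ <;>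
        simp only [norm_mul, Complex.norm_exp_ofReal_mul_I, mul_one, Complex.norm_real,
          Real.norm_eq_abs, sq_abs]
      rw [Complex.re_ofReal_mul, Complex.exp_ofReal_mul_I_re, hcos, mul_pow, mul_comm]
  · have hcos_le : Real.cos w.arg ≤ t :=
      hcos ▸ Real.cos_le_cos_of_nonneg_of_le_pi (Real.arccos_nonneg t) (Complex.arg_le_pi w) hgt.le
    have hre_le : w.re ≤ t * ‖w‖ := by
      rw [← Complex.norm_mul_cos_arg, mul_comm]
      gcongr
    refine (growth_le (mul_pow t ‖w‖ 2 ▸ pow_le_pow_left₀ hre hre_le 2)).trans ?_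
    gcongr C * Real.exp (?_ * _)
    exact mul_le_of_le_one_right (by positivity) ht₁.le

end PhragmenLindelof

section WholePlane

variable {K t C : ℝ} {k : ℂ → ℂ}

theorem norm_le_exp_of_real_axis (hK : 0 ≤ K) (ht₀ : 0 < t) (ht₁ : t < 1)
    (hk : Differentiable ℂ k)
    (hgrowth : ∀ w : ℂ, ‖k w‖ ≤ C * Real.exp (K * w.re ^ 2 + K * t ^ 2 * w.im ^ 2))
    (hreal : ∀ u : ℝ, ‖k u‖ ≤ C * Real.exp (K * t ^ 2 * u ^ 2)) (w : ℂ) :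
    ‖k w‖ ≤ C * Real.exp (2 * K * t * ‖w‖ ^ 2) := by
  wlog hre : 0 ≤ w.re generalizing k w
  · simpa using this (k := fun z => k (-z)) (hk.comp differentiable_neg)
      (fun z => by simpa using hgrowth (-z)) (fun u => by simpa using hreal (-u)) (-w)
      (by simpa using (not_le.1 hre).le)
  wlog him : 0 ≤ w.im generalizing k w
  · simpa using this (k := starRingEnd ℂ ∘ k ∘ starRingEnd ℂ)
      (fun z => differentiableAt_conj_conj_iff.2 (hk _))
      (fun z => by simpa using hgrowth (starRingEnd ℂ z)) (fun u => by simpa using hreal u)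
      (starRingEnd ℂ w) (by simpa using hre) (by simpa using (not_le.1 him).le)
  exact norm_le_exp_of_first_quadrant hK ht₀ ht₁ hk hgrowth hreal hre him

theorem norm_le_of_real_axis (hK : 0 ≤ K) (hk : Differentiable ℂ k)
    (hgrowth : ∀ w : ℂ, ‖k w‖ ≤ C * Real.exp (K * w.re ^ 2)) (hreal : ∀ u : ℝ, ‖k u‖ ≤ C)
    (w : ℂ) : ‖k w‖ ≤ C := by
  have hC : 0 ≤ C := (norm_nonneg _).trans (hreal 0)
  have hlim : Tendsto (fun t => C * Real.exp (2 * K * t * ‖w‖ ^ 2)) (nhdsWithin 0 (Set.Ioi 0))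
      (nhds C) :=
    (Continuous.tendsto' (by fun_prop) 0 C (by simp)).mono_left nhdsWithin_le_nhds
  refine ge_of_tendsto hlim ?_
  filter_upwards [Ioo_mem_nhdsGT one_pos] with t ht
  refine norm_le_exp_of_real_axis hK ht.1 ht.2 hk (fun w => (hgrowth w).trans ?_)
    (fun u => (hreal u).trans ?_) w
  · gcongr
    exact le_add_of_nonneg_right (by positivity)
  · exact le_mul_of_one_le_right hC (Real.one_le_exp (by positivity))

end WholePlane

/-! ### Gaussian decay -/

/-- `f` decays like `exp (-a ‖x‖² / 2)` at infinity, up to factors `exp (ε ‖x‖²)` with arbitrary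
`ε > 0`. This absorbs the functions `P` and `Q` of `Condition`. Negative rates are allowed; in
particular rate `0` means growth of at most minimal type with respect to the order `2`. -/
def HasGaussianDecay {E F : Type*} [NormedAddCommGroup E] [NormedAddCommGroup F] (a : ℝ)
    (f : E → F) : Prop :=
  ∀ a' < a, f =O[Bornology.cobounded E] fun x => Real.exp (-(a' * ‖x‖ ^ 2 / 2))

section HasGaussianDecay

variable {E F : Type*} [NormedAddCommGroup E] [NormedAddCommGroup F] {a b : ℝ} {f : E → F}

theorem hasGaussianDecay_of_norm_le {C : ℝ}
    (hf : ∀ x, ‖f x‖ ≤ C * Real.exp (-(a * ‖x‖ ^ 2 / 2))) : HasGaussianDecay a f := by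
  refine fun a' ha' => .of_bound |C| (.of_forall fun x => (hf x).trans ?_)
  rw [Real.norm_of_nonneg (Real.exp_pos _).le]
  gcongr
  exact le_abs_self C

theorem hasGaussianDecay_exp (c : ℝ) :
    HasGaussianDecay c fun x : E => Real.exp (-(c * ‖x‖ ^ 2 / 2)) :=
  hasGaussianDecay_of_norm_le (C := 1) fun x => by simp

theorem hasGaussianDecay_const (y : F) : HasGaussianDecay 0 fun _ : E => y :=
  hasGaussianDecay_of_norm_le (C := ‖y‖) fun x => by simp

theorem tendsto_const_mul_norm_sq_cobounded {c : ℝ} (hc : 0 < c) :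
    Tendsto (fun x : E => c * ‖x‖ ^ 2) (Bornology.cobounded E) atTop :=
  ((tendsto_pow_atTop two_ne_zero).comp tendsto_norm_cobounded_atTop).const_mul_atTop hc

theorem hasGaussianDecay_iff_eventually_norm_le : HasGaussianDecay a f ↔
    ∀ a' < a, ∀ᶠ x in Bornology.cobounded E, ‖f x‖ ≤ Real.exp (-(a' * ‖x‖ ^ 2 / 2)) := by
  refine ⟨fun hf a' ha' => ?_, fun hf a' ha' =>
    .of_bound 1 ((hf a' ha').mono fun x hx => by simpa using hx)⟩
  obtain ⟨c, ha'c, hca⟩ := exists_between ha'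
  have hexp : (fun x : E => Real.exp (-(c * ‖x‖ ^ 2 / 2))) =o[Bornology.cobounded E]
      fun x => Real.exp (-(a' * ‖x‖ ^ 2 / 2)) := by
    refine Real.isLittleO_exp_comp_exp_comp.2 ?_
    refine (tendsto_const_mul_norm_sq_cobounded (half_pos (sub_pos.2 ha'c))).congr fun x => ?_
    ring
  simpa using ((hf c hca).trans_isLittleO hexp).bound one_pos

namespace HasGaussianDecay

theorem mono (hf : HasGaussianDecay a f) (hba : b ≤ a) : HasGaussianDecay b f :=
  fun a' ha' => hf a' (ha'.trans_le hba)

theorem norm (hf : HasGaussianDecay a f) : HasGaussianDecay a fun x => ‖f x‖ :=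
  fun a' ha' => (hf a' ha').norm_left

theorem add {g : E → F} (hf : HasGaussianDecay a f) (hg : HasGaussianDecay a g) :
    HasGaussianDecay a fun x => f x + g x :=
  fun a' ha' => (hf a' ha').add (hg a' ha')

theorem mul {R : Type*} [NormedRing R] {f g : E → R} (hf : HasGaussianDecay a f)
    (hg : HasGaussianDecay b g) : HasGaussianDecay (a + b) fun x => f x * g x := by
  intro c hc
  refine ((hf (a - (a + b - c) / 2) (by linarith)).mul
    (hg (b - (a + b - c) / 2) (by linarith))).congr_right fun x => ?_
  rw [← Real.exp_add]
  ring_nf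

theorem const_mul {R : Type*} [NormedRing R] {f : E → R} (r : R) (hf : HasGaussianDecay a f) :
    HasGaussianDecay a fun x => r * f x := by
  simpa using (hasGaussianDecay_const r).mul hf

theorem comp_smul {𝕜 : Type*} [NormedField 𝕜] [NormedSpace 𝕜 E] (hf : HasGaussianDecay a f)
    {c : 𝕜} (hc : c ≠ 0) : HasGaussianDecay (a * ‖c‖ ^ 2) fun x => f (c • x) := by
  have hc' : 0 < ‖c‖ := norm_pos_iff.2 hc
  have htendsto : Tendsto (c • · : E → E) (Bornology.cobounded E) (Bornology.cobounded E) := by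
    rw [← tendsto_norm_atTop_iff_cobounded]
    simpa only [norm_smul] using tendsto_norm_cobounded_atTop.const_mul_atTop hc'
  intro a' ha'
  refine ((hf (a' / ‖c‖ ^ 2) ((div_lt_iff₀ (by positivity)).2 ha')).comp_tendsto
    htendsto).congr_right fun x => ?_
  simp only [Function.comp_apply, norm_smul]
  field_simp

theorem exists_norm_le [ProperSpace E] (hf : HasGaussianDecay a f) (hcont : Continuous f)
    {a' : ℝ} (ha' : a' < a) : ∃ C, ∀ x, ‖f x‖ ≤ C * Real.exp (-(a' * ‖x‖ ^ 2 / 2)) := by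
  obtain ⟨R, -, hR⟩ := hasBasis_cobounded_norm.eventually_iff.1
    (hasGaussianDecay_iff_eventually_norm_le.1 hf a' ha')
  obtain ⟨C, hC⟩ := (isCompact_closedBall (0 : E) R).exists_bound_of_continuousOn
    (f := fun x => Real.exp (a' * ‖x‖ ^ 2 / 2) * ‖f x‖) (by fun_prop)
  refine ⟨max C 1, fun x => ?_⟩
  rw [Real.exp_neg, ← div_eq_mul_inv, le_div_iff₀' (Real.exp_pos _)]
  rcases le_total ‖x‖ R with hx | hx
  · exact (le_abs_self _).trans ((hC x (by simpa using hx)).trans (le_max_left _ _))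
  · refine le_max_of_le_right ?_
    rw [← le_div_iff₀' (Real.exp_pos _), one_div, ← Real.exp_neg]
    exact hR hx

theorem congr_ae [MeasurableSpace E] {μ : Measure E} [μ.IsOpenPosMeasure]
    {g : E → F} (hf : HasGaussianDecay a f) (hfg : f =ᵐ[μ] g) (hg : Continuous g) :
    HasGaussianDecay a g := by
  refine hasGaussianDecay_iff_eventually_norm_le.2 fun a' ha' => ?_
  obtain ⟨R, -, hR⟩ := hasBasis_cobounded_norm.eventually_iff.1
    (hasGaussianDecay_iff_eventually_norm_le.1 hf a' ha')
  let U : Set E := {x | R < ‖x‖} ∩ {x | Real.exp (-(a' * ‖x‖ ^ 2 / 2)) < ‖g x‖}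
  have hopen : IsOpen U :=
    (isOpen_lt (by fun_prop) (by fun_prop)).inter (isOpen_lt (by fun_prop) (by fun_prop))
  have hne : U ⊆ {x | ¬f x = g x} := by
    rintro x ⟨hRx : R < ‖x‖, hlt : Real.exp _ < ‖g x‖⟩ (hfgx : f x = g x)
    exact (hR hRx.le).not_gt (hfgx ▸ hlt)
  have hnull : μ U = 0 := measure_mono_null hne (ae_iff.1 hfg)
  have hempty : U = ∅ := (hopen.measure_eq_zero_iff μ).1 hnull
  filter_upwards [tendsto_norm_cobounded_atTop.eventually_gt_atTop R] with x hx
  by_contra! hlt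
  exact Set.eq_empty_iff_forall_notMem.1 hempty x ⟨hx, hlt⟩

end HasGaussianDecay

end HasGaussianDecay

section Integrability

variable {V : Type*} [NormedAddCommGroup V] [InnerProductSpace ℝ V] [FiniteDimensional ℝ V]
  [MeasurableSpace V] [BorelSpace V] {F : Type*} [NormedAddCommGroup F] {a : ℝ} {f : V → F}

theorem integrable_exp_neg_mul_norm_sq {c : ℝ} (hc : 0 < c) :
    Integrable fun x : V => Real.exp (-(c * ‖x‖ ^ 2 / 2)) := by
  have hgauss := GaussianFourier.integrable_cexp_neg_mul_sq_norm_add (V := V)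
    (b := ((c / 2 : ℝ) : ℂ)) (by simpa using hc) 0 0
  refine hgauss.norm.congr (.of_forall fun x => ?_)
  simp only [zero_mul, add_zero, Complex.norm_exp]
  rw [← Complex.ofReal_neg, ← Complex.ofReal_pow, ← Complex.ofReal_mul, Complex.ofReal_re]
  ring_nf

theorem HasGaussianDecay.integrable (hf : HasGaussianDecay a f) (ha : 0 < a)
    (hloc : LocallyIntegrable f) : Integrable f := by
  refine hloc.integrable_of_isBigO_cocompact (g := fun x : V => Real.exp (-(a / 2 * ‖x‖ ^ 2 / 2)))
    ?_ ⟨Set.univ, univ_mem, (integrable_exp_neg_mul_norm_sq (half_pos ha)).integrableOn⟩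
  rw [← Metric.cobounded_eq_cocompact]
  exact hf _ (half_lt_self ha)

theorem HasGaussianDecay.integrable_exp_mul (hf : HasGaussianDecay a f) (hint : Integrable f)
    {a' : ℝ} (ha' : a' < a) : Integrable fun x => Real.exp (a' * ‖x‖ ^ 2 / 2) * ‖f x‖ := by
  have hdecay := (hasGaussianDecay_exp (E := V) (-a')).mul hf.norm
  simp only [neg_mul, neg_div, neg_neg] at hdecay
  exact hdecay.integrable (by linarith)
    (hint.norm.locallyIntegrable.continuous_mul (by fun_prop))

end Integrability

/-! ### Logarithmic growth -/

section Growth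

theorem limsup_log_div_le_zero_iff {α : Type*} {l : Filter α} {u : α → ℝ≥0∞} {v : α → ℝ}
    (hv : ∀ᶠ x in l, 0 < v x) :
    limsup (fun x => ENNReal.log (u x) / (v x : EReal)) l ≤ 0 ↔
      ∀ ε > 0, ∀ᶠ x in l, u x ≤ ENNReal.ofReal (Real.exp (ε * v x)) := by
  have log_div_le {x : α} (hx : 0 < v x) (ε : ℝ) : ENNReal.log (u x) / (v x : EReal) ≤ ε ↔
      u x ≤ ENNReal.ofReal (Real.exp (ε * v x)) := by
    rw [EReal.div_le_iff_le_mul (by exact_mod_cast hx) (EReal.coe_ne_top _), ← EReal.coe_mul,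
      ← ENNReal.log_le_log_iff, ENNReal.log_ofReal_of_pos (Real.exp_pos _), Real.log_exp,
      mul_comm]
  constructor
  · intro h ε hε
    have hlt : limsup (fun x => ENNReal.log (u x) / (v x : EReal)) l < (ε : EReal) :=
      h.trans_lt (by exact_mod_cast hε)
    filter_upwards [eventually_lt_of_limsup_lt hlt, hv] with x hx hvx
    exact (log_div_le hvx ε).1 hx.le
  · refine fun h => EReal.le_of_forall_lt_iff_le.1 fun ε hε => limsup_le_of_le (h := ?_)
    filter_upwards [h ε (by exact_mod_cast hε), hv] with x hx hvx
    exact (log_div_le hvx ε).2 hx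

variable {n : ℕ} {P : EuclideanSpace ℝ (Fin n) → ℝ}

theorem logGrowth_le_zero_iff : logGrowth P ≤ 0 ↔
    ∀ ε > 0, ∀ᶠ x in Bornology.cobounded (EuclideanSpace ℝ (Fin n)),
      P x ≤ Real.exp (ε * ‖x‖ ^ 2) := by
  have hpos : ∀ᶠ x in Bornology.cobounded (EuclideanSpace ℝ (Fin n)), 0 < ‖x‖ ^ 2 :=
    (tendsto_norm_cobounded_atTop.eventually_gt_atTop 0).mono fun x hx => pow_pos hx 2
  simp only [logGrowth, limsup_log_div_le_zero_iff hpos,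
    ENNReal.ofReal_le_ofReal_iff (Real.exp_pos _).le]

theorem HasGaussianDecay.logGrowth_eq_zero [NeZero n] (hP : HasGaussianDecay 0 P)
    (hone : ∀ x, 1 ≤ P x) : logGrowth P = 0 := by
  refine le_antisymm (logGrowth_le_zero_iff.2 fun ε hε => ?_) ?_
  · filter_upwards [hasGaussianDecay_iff_eventually_norm_le.1 hP (-(2 * ε)) (by linarith)]
      with x hx
    refine (le_abs_self _).trans (hx.trans_eq ?_)
    ring_nf
  · refine le_limsup_of_frequently_le (Eventually.frequently (.of_forall fun x => ?_))
    refine EReal.div_nonneg ?_ (by exact_mod_cast sq_nonneg ‖x‖)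
    rw [ENNReal.zero_le_log_iff]
    exact ENNReal.one_le_ofReal.2 (hone x)

theorem hasGaussianDecay_of_logGrowth_le_zero {F : Type*} [NormedAddCommGroup F] {a : ℝ}
    {f : EuclideanSpace ℝ (Fin n) → F} (hP : logGrowth P ≤ 0)
    (hf : ∀ x, ‖f x‖ ≤ P x * Real.exp (-(a * ‖x‖ ^ 2 / 2))) : HasGaussianDecay a f := by
  refine hasGaussianDecay_iff_eventually_norm_le.2 fun a' ha' => ?_
  filter_upwards [logGrowth_le_zero_iff.1 hP ((a - a') / 2) (by linarith)] with x hx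
  calc ‖f x‖ ≤ P x * Real.exp (-(a * ‖x‖ ^ 2 / 2)) := hf x
    _ ≤ Real.exp ((a - a') / 2 * ‖x‖ ^ 2) * Real.exp (-(a * ‖x‖ ^ 2 / 2)) := by gcongr
    _ = Real.exp (-(a' * ‖x‖ ^ 2 / 2)) := by rw [← Real.exp_add]; ring_nf

theorem HasGaussianDecay.exists_logGrowth_eq_zero [NeZero n] {F : Type*} [NormedAddCommGroup F]
    {a : ℝ} {f : EuclideanSpace ℝ (Fin n) → F} (hf : HasGaussianDecay a f) :
    ∃ P : EuclideanSpace ℝ (Fin n) → ℝ, logGrowth P = 0 ∧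
      ∀ x, ‖f x‖ ≤ P x * Real.exp (-(a * ‖x‖ ^ 2 / 2)) := by
  have hquot : HasGaussianDecay 0 fun x => ‖f x‖ * Real.exp (-(-a * ‖x‖ ^ 2 / 2)) := by
    simpa using hf.norm.mul (hasGaussianDecay_exp (-a))
  refine ⟨fun x => 1 + ‖f x‖ * Real.exp (-(-a * ‖x‖ ^ 2 / 2)),
    ((hasGaussianDecay_const 1).add hquot).logGrowth_eq_zero fun x => ?_, fun x => ?_⟩
  · exact le_add_of_nonneg_right (by positivity)
  · rw [add_mul, mul_assoc, ← Real.exp_add]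
    ring_nf
    simp [Real.exp_nonneg]

theorem exists_condition_iff [NeZero n] {a b : ℝ} {f : EuclideanSpace ℝ (Fin n) → ℂ} :
    (∃ P Q, Condition a b P Q f) ↔
      Integrable f ∧ HasGaussianDecay a f ∧ HasGaussianDecay b (fourier f) := by
  constructor
  · rintro ⟨P, Q, hf⟩
    exact ⟨hf.integrable, hasGaussianDecay_of_logGrowth_le_zero hf.logGrowth_left.le hf.bound,
      hasGaussianDecay_of_logGrowth_le_zero hf.logGrowth_right.le hf.bound_fourier⟩
  · rintro ⟨hint, hf, hfourier⟩
    obtain ⟨P, hP, hfP⟩ := hf.exists_logGrowth_eq_zero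
    obtain ⟨Q, hQ, hfQ⟩ := hfourier.exists_logGrowth_eq_zero
    exact ⟨P, Q, hint, hfP, hfQ, hP, hQ⟩

theorem HasGaussianDecay.isEntireMinimalType {F : EuclideanSpace ℂ (Fin n) → ℂ}
    (hF : HasGaussianDecay 0 F) (hdiff : Differentiable ℂ F) : IsEntireMinimalType F := by
  have htype : growthType 2 F ≤ 0 := by
    refine (limsup_log_div_le_zero_iff ?_).2 fun ε hε => ?_
    · exact (eventually_gt_atTop 0).mono fun r hr => Real.rpow_pos_of_pos hr 2
    obtain ⟨C, hC⟩ := hF.exists_norm_le hdiff.continuous (neg_lt_zero.2 hε)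
    have hlim : Tendsto (fun r : ℝ => ε / 2 * r ^ 2) atTop atTop :=
      (tendsto_pow_atTop two_ne_zero).const_mul_atTop (half_pos hε)
    filter_upwards [(Real.tendsto_exp_atTop.comp hlim).eventually_ge_atTop C]
      with r hr
    refine iSup₂_le fun z hz => ?_
    rw [← ofReal_norm]
    refine ENNReal.ofReal_le_ofReal ?_
    calc ‖F z‖ ≤ C * Real.exp (-(-ε * ‖z‖ ^ 2 / 2)) := hC z
      _ ≤ Real.exp (ε / 2 * r ^ 2) * Real.exp (-(-ε * ‖z‖ ^ 2 / 2)) := by gcongr; exact hr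
      _ ≤ Real.exp (ε / 2 * r ^ 2) * Real.exp (ε / 2 * r ^ 2) := by
        gcongr
        have : ‖z‖ ^ 2 ≤ r ^ 2 := by gcongr; simpa using hz
        nlinarith only [this, hε]
      _ = Real.exp (ε * r ^ (2 : ℝ)) := by rw [← Real.exp_add, Real.rpow_two]; ring_nf
  refine ⟨hdiff, ?_, htype⟩
  exact iInf_le_of_le 2 (iInf_le_of_le zero_le_two
    (iInf_le_of_le (htype.trans_lt EReal.zero_lt_top) le_rfl))

end Growth

/-! ### Fourier inversion almost everywhere -/

section FourierInversion

open scoped FourierTransform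

variable {V E : Type*} [NormedAddCommGroup V] [InnerProductSpace ℝ V] [FiniteDimensional ℝ V]
  [MeasurableSpace V] [BorelSpace V] [NormedAddCommGroup E] [NormedSpace ℂ E]

theorem continuous_fourierInv {f : V → E} (hf : Integrable f) : Continuous (𝓕⁻ f) :=
  VectorFourier.fourierIntegral_continuous (L := -innerₗ V) Real.continuous_fourierChar
    (continuous_inner (𝕜 := ℝ) (E := V)).neg hf

variable [CompleteSpace E]

theorem integral_fourier_smul_eq {f : V → ℂ} {g : V → E} (hf : Integrable f) (hg : Integrable g) :
    ∫ ξ, 𝓕 f ξ • g ξ = ∫ x, f x • 𝓕 g x := by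
  have := VectorFourier.integral_fourierIntegral_smul_eq_flip (L := innerₗ V)
    Real.continuous_fourierChar continuous_inner hf hg
  rwa [flip_innerₗ] at this

theorem integral_fourierInv_smul_eq {f : V → ℂ} {g : V → E} (hf : Integrable f)
    (hg : Integrable g) : ∫ ξ, 𝓕⁻ f ξ • g ξ = ∫ x, f x • 𝓕⁻ g x := by
  calc ∫ ξ, 𝓕⁻ f ξ • g ξ = ∫ ξ, 𝓕 f ξ • g (-ξ) := by
        rw [← integral_neg_eq_self]
        simp only [Real.fourierInv_eq_fourier_neg, neg_neg]
    _ = ∫ x, f x • 𝓕⁻ g x := by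
        rw [Real.fourierInv_eq_fourier_comp_neg]
        exact integral_fourier_smul_eq hf hg.comp_neg

theorem ae_eq_fourierInv_fourier {f : V → E} (hf : Integrable f) (hf' : Integrable (𝓕 f)) :
    f =ᵐ[volume] 𝓕⁻ (𝓕 f) := by
  refine ae_eq_of_integral_contDiff_smul_eq hf.locallyIntegrable
    (continuous_fourierInv hf').locallyIntegrable fun g hg hgs => ?_
  have hgs' : HasCompactSupport fun x => (g x : ℂ) := hgs.comp_left Complex.ofReal_zero
  let φ : SchwartzMap V ℂ := hgs'.toSchwartzMap (Complex.ofRealCLM.contDiff.comp hg)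
  have hφ : 𝓕 (𝓕⁻ (φ : V → ℂ)) = φ := by
    rw [← SchwartzMap.fourierInv_coe, ← SchwartzMap.fourier_coe,
      FourierTransform.fourier_fourierInv_eq]
  have hφ_int : Integrable (𝓕⁻ (φ : V → ℂ)) := by
    rw [← SchwartzMap.fourierInv_coe]
    exact SchwartzMap.integrable _
  calc ∫ x, g x • f x = ∫ x, 𝓕 (𝓕⁻ (φ : V → ℂ)) x • f x := by
        rw [hφ]
        rfl
    _ = ∫ x, 𝓕⁻ (φ : V → ℂ) x • 𝓕 f x := integral_fourier_smul_eq hφ_int hf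
    _ = ∫ x, φ x • 𝓕⁻ (𝓕 f) x := integral_fourierInv_smul_eq φ.integrable hf'
    _ = ∫ x, g x • 𝓕⁻ (𝓕 f) x := rfl

end FourierInversion

section Dilation

open scoped FourierTransform

theorem fourierTransform_comp_smul {V E : Type*} [NormedAddCommGroup V] [InnerProductSpace ℝ V]
    [FiniteDimensional ℝ V] [MeasurableSpace V] [BorelSpace V] [NormedAddCommGroup E]
    [NormedSpace ℂ E] (f : V → E) {c : ℝ} (hc : c ≠ 0) (ξ : V) :
    𝓕 (fun x => f (c • x)) ξ = |(c ^ Module.finrank ℝ V)⁻¹| • 𝓕 f (c⁻¹ • ξ) := by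
  rw [Real.fourier_eq, Real.fourier_eq, ← Measure.integral_comp_smul]
  simp only [real_inner_smul_left, real_inner_smul_right, inv_mul_cancel_left₀ hc]

variable {n : ℕ} (f : EuclideanSpace ℝ (Fin n) → ℂ)

theorem fourier_eq_mul_fourierTransform (ξ : EuclideanSpace ℝ (Fin n)) :
    fourier f ξ = ((2 * Real.pi) ^ (-(n : ℝ) / 2) : ℝ) * 𝓕 f ((2 * Real.pi)⁻¹ • ξ) := by
  rw [fourier, Real.fourier_eq']
  congr 2
  ext x
  have hpi : (Real.pi : ℂ) ≠ 0 := by exact_mod_cast Real.pi_ne_zero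
  rw [smul_eq_mul, inner_smul_right]
  push_cast
  congr 2
  field_simp

theorem fourierTransform_eq_mul_fourier (ξ : EuclideanSpace ℝ (Fin n)) :
    𝓕 f ξ = ((2 * Real.pi) ^ ((n : ℝ) / 2) : ℝ) * fourier f ((2 * Real.pi) • ξ) := by
  rw [fourier_eq_mul_fourierTransform, inv_smul_smul₀ Real.two_pi_pos.ne', ← mul_assoc,
    ← Complex.ofReal_mul, ← Real.rpow_add Real.two_pi_pos]
  simp [neg_div]

theorem fourier_comp_smul {c : ℝ} (hc : c ≠ 0) (ξ : EuclideanSpace ℝ (Fin n)) :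
    fourier (fun x => f (c • x)) ξ = (|(c ^ n)⁻¹| : ℝ) * fourier f (c⁻¹ • ξ) := by
  rw [fourier_eq_mul_fourierTransform, fourier_eq_mul_fourierTransform,
    fourierTransform_comp_smul f hc, smul_comm, finrank_euclideanSpace_fin, Complex.real_smul]
  ring

theorem fourier_const_mul (c : ℂ) (ξ : EuclideanSpace ℝ (Fin n)) :
    fourier (fun x => c * f x) ξ = c * fourier f ξ := by
  simp only [fourier, mul_left_comm _ c, integral_const_mul]

theorem fourier_fourier_neg (x : EuclideanSpace ℝ (Fin n)) :
    fourier (fun ξ => fourier f (-ξ)) x = 𝓕⁻ (𝓕 f) x := by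
  have hπ : (2 * Real.pi) ^ (-(n : ℝ) / 2) * (2 * Real.pi) ^ (-(n : ℝ) / 2) *
      (2 * Real.pi) ^ n = 1 := by
    rw [← Real.rpow_add Real.two_pi_pos, ← Real.rpow_natCast, ← Real.rpow_add Real.two_pi_pos]
    ring_nf
    simp
  have fourier_neg (ξ : EuclideanSpace ℝ (Fin n)) : fourier f (-ξ) =
      ((2 * Real.pi) ^ (-(n : ℝ) / 2) : ℝ) * 𝓕 f ((-(2 * Real.pi)⁻¹ : ℝ) • ξ) := by
    rw [fourier_eq_mul_fourierTransform, smul_neg, neg_smul]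
  simp only [fourier_neg, fourier_const_mul]
  rw [fourier_comp_smul (𝓕 f) (by simp [Real.pi_ne_zero]), fourier_eq_mul_fourierTransform,
    Real.fourierInv_eq_fourier_neg, inv_neg, inv_inv, smul_smul, mul_neg,
    inv_mul_cancel₀ Real.two_pi_pos.ne', neg_one_smul, abs_inv, abs_pow, abs_neg, abs_inv,
    abs_of_pos Real.two_pi_pos, inv_pow, inv_inv]
  simp only [← mul_assoc, ← Complex.ofReal_mul]
  rw [mul_right_comm, hπ, Complex.ofReal_one, one_mul]

theorem ae_eq_fourier_fourier_neg {f : EuclideanSpace ℝ (Fin n) → ℂ} (hf : Integrable f)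
    (hf' : Integrable (fourier f)) : f =ᵐ[volume] fourier fun ξ => fourier f (-ξ) := by
  have hint : Integrable (𝓕 f) := by
    rw [funext (fourierTransform_eq_mul_fourier f)]
    exact (hf'.comp_smul Real.two_pi_pos.ne').const_mul _
  rw [funext (fourier_fourier_neg f)]
  exact ae_eq_fourierInv_fourier hf hint

end Dilation

/-! ### The Fourier transform at complex frequencies -/

section FourierExt

variable {n : ℕ}

@[simp]
theorem toComplex_apply (x : EuclideanSpace ℝ (Fin n)) (j : Fin n) : toComplex x j = (x j : ℂ) :=
  rfl

@[simp]
theorem norm_toComplex (x : EuclideanSpace ℝ (Fin n)) : ‖toComplex x‖ = ‖x‖ := by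
  simp [EuclideanSpace.norm_eq]

@[fun_prop]
theorem continuous_toComplex :
    Continuous (toComplex : EuclideanSpace ℝ (Fin n) → EuclideanSpace ℂ (Fin n)) := by
  unfold toComplex
  fun_prop

theorem inner_toComplex (x y : EuclideanSpace ℝ (Fin n)) :
    inner ℂ (toComplex x) (toComplex y) = ((inner ℝ x y : ℝ) : ℂ) := by
  simp [PiLp.inner_apply]

theorem sq_smul_toComplex (w : ℂ) (x : EuclideanSpace ℝ (Fin n)) :
    sq (w • toComplex x) = w ^ 2 * (‖x‖ ^ 2 : ℝ) := by
  simp [sq, EuclideanSpace.norm_sq_eq, mul_pow, Finset.mul_sum]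

theorem ofReal_smul_toComplex (u : ℝ) (x : EuclideanSpace ℝ (Fin n)) :
    (u : ℂ) • toComplex x = toComplex (u • x) := by
  ext j
  simp

/-- The exponential `exp (-i x·z)` at a complex frequency `z`; the inner product on `ℂⁿ` is
bilinear here because its first, conjugate-linear, argument is real. -/
noncomputable def fourierKernel (x : EuclideanSpace ℝ (Fin n)) (z : EuclideanSpace ℂ (Fin n)) : ℂ :=
  Complex.exp (-Complex.I * inner ℂ (toComplex x) z)

/-- The extension of `fourier f` to complex frequencies; it is an entire function on `ℂⁿ` if `f`
decays fast enough for the integrals to converge. -/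
noncomputable def fourierExt (f : EuclideanSpace ℝ (Fin n) → ℂ) (z : EuclideanSpace ℂ (Fin n)) :
    ℂ :=
  ((2 * Real.pi) ^ (-(n : ℝ) / 2) : ℝ) * ∫ x, fourierKernel x z * f x

theorem fourierExt_toComplex (f : EuclideanSpace ℝ (Fin n) → ℂ) (ξ : EuclideanSpace ℝ (Fin n)) :
    fourierExt f (toComplex ξ) = fourier f ξ := by
  simp only [fourierExt, fourierKernel, fourier, inner_toComplex]

theorem continuous_fourierKernel (z : EuclideanSpace ℂ (Fin n)) :
    Continuous fun x => fourierKernel x z := by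
  unfold fourierKernel
  fun_prop

theorem hasFDerivAt_fourierKernel (x : EuclideanSpace ℝ (Fin n)) (z : EuclideanSpace ℂ (Fin n)) :
    HasFDerivAt (fourierKernel x)
      (fourierKernel x z • (-Complex.I • innerSL ℂ (toComplex x))) z :=
  ((innerSL ℂ (toComplex x)).hasFDerivAt.const_mul (-Complex.I)).cexp

theorem norm_fourierKernel_le (x : EuclideanSpace ℝ (Fin n)) (z : EuclideanSpace ℂ (Fin n)) :
    ‖fourierKernel x z‖ ≤ Real.exp (‖x‖ * ‖z‖) := by
  refine (Complex.norm_exp_le_exp_norm _).trans (Real.exp_le_exp.2 ?_)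
  rw [norm_mul, norm_neg, Complex.norm_I, one_mul, ← norm_toComplex x]
  exact norm_inner_le_norm _ _

theorem norm_fourierKernel_smul_toComplex (x y : EuclideanSpace ℝ (Fin n)) (w : ℂ) :
    ‖fourierKernel x (w • toComplex y)‖ = Real.exp (w.im * inner ℝ x y) := by
  rw [fourierKernel, inner_smul_right, inner_toComplex, Complex.norm_exp]
  simp [Complex.mul_re, Complex.mul_im]

variable {f : EuclideanSpace ℝ (Fin n) → ℂ} {a : ℝ}

theorem norm_fourierExt_smul_toComplex_le (ha : 0 < a)
    (hint : Integrable fun x => Real.exp (a * ‖x‖ ^ 2 / 2) * ‖f x‖) (w : ℂ)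
    (y : EuclideanSpace ℝ (Fin n)) :
    ‖fourierExt f (w • toComplex y)‖ ≤
      (2 * Real.pi) ^ (-(n : ℝ) / 2) * (∫ x, Real.exp (a * ‖x‖ ^ 2 / 2) * ‖f x‖) *
        Real.exp (w.im ^ 2 * ‖y‖ ^ 2 / (2 * a)) := by
  have young (x : EuclideanSpace ℝ (Fin n)) :
      w.im * inner ℝ x y ≤ a * ‖x‖ ^ 2 / 2 + w.im ^ 2 * ‖y‖ ^ 2 / (2 * a) := by
    have hinner : w.im * inner ℝ x y ≤ ‖x‖ * (|w.im| * ‖y‖) := by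
      rw [← real_inner_smul_right, ← Real.norm_eq_abs, ← norm_smul]
      exact real_inner_le_norm _ _
    have hsq := two_mul_le_add_mul_sq (a := ‖x‖) (b := |w.im| * ‖y‖) ha
    rw [mul_pow, sq_abs] at hsq
    calc w.im * inner ℝ x y ≤ (a * ‖x‖ ^ 2 + a⁻¹ * (w.im ^ 2 * ‖y‖ ^ 2)) / 2 := by linarith
      _ = a * ‖x‖ ^ 2 / 2 + w.im ^ 2 * ‖y‖ ^ 2 / (2 * a) := by field_simp
  rw [fourierExt, norm_mul, Complex.norm_real, Real.norm_of_nonneg (by positivity), mul_assoc,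
    ← integral_mul_const]
  gcongr
  refine norm_integral_le_of_norm_le (hint.mul_const _) (.of_forall fun x => ?_)
  rw [norm_mul, norm_fourierKernel_smul_toComplex, mul_right_comm, ← Real.exp_add]
  gcongr
  exact young x

theorem norm_fourierKernel_mul_le (ha : 0 < a) {M : ℝ} (x : EuclideanSpace ℝ (Fin n))
    {z : EuclideanSpace ℂ (Fin n)} (hz : ‖z‖ ≤ M) :
    ‖fourierKernel x z‖ * (1 + ‖x‖) ≤
      Real.exp ((M + 1) ^ 2 / (2 * a)) * Real.exp (a * ‖x‖ ^ 2 / 2) := by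
  have young : ‖x‖ * M + ‖x‖ ≤ (M + 1) ^ 2 / (2 * a) + a * ‖x‖ ^ 2 / 2 := by
    have hsq := two_mul_le_add_mul_sq (a := ‖x‖) (b := M + 1) ha
    calc ‖x‖ * M + ‖x‖ ≤ (a * ‖x‖ ^ 2 + a⁻¹ * (M + 1) ^ 2) / 2 := by linarith
      _ = (M + 1) ^ 2 / (2 * a) + a * ‖x‖ ^ 2 / 2 := by field_simp; ring
  calc ‖fourierKernel x z‖ * (1 + ‖x‖) ≤ Real.exp (‖x‖ * M) * Real.exp ‖x‖ := by
        gcongr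
        · exact (norm_fourierKernel_le x z).trans (by gcongr)
        · linarith [Real.add_one_le_exp ‖x‖]
    _ ≤ Real.exp ((M + 1) ^ 2 / (2 * a)) * Real.exp (a * ‖x‖ ^ 2 / 2) := by
        rw [← Real.exp_add, ← Real.exp_add]
        gcongr

theorem differentiable_fourierExt (hf : AEStronglyMeasurable f volume) (ha : 0 < a)
    (hint : Integrable fun x => Real.exp (a * ‖x‖ ^ 2 / 2) * ‖f x‖) :
    Differentiable ℂ (fourierExt f) := by
  intro z₀
  let bound := fun x => Real.exp ((‖z₀‖ + 1 + 1) ^ 2 / (2 * a)) *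
    (Real.exp (a * ‖x‖ ^ 2 / 2) * ‖f x‖)
  have hbound {z} (hz : z ∈ Metric.ball z₀ 1) (x) :
      ‖fourierKernel x z‖ * (1 + ‖x‖) * ‖f x‖ ≤ bound x :=
    (mul_le_mul_of_nonneg_right (norm_fourierKernel_mul_le ha x (norm_lt_of_mem_ball hz).le)
      (norm_nonneg _)).trans_eq (mul_assoc _ _ _)
  have hmeas (z) : AEStronglyMeasurable (fun x => fourierKernel x z * f x) volume :=
    (continuous_fourierKernel z).aestronglyMeasurable.mul hf
  refine DifferentiableAt.const_mul ?_ _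
  refine (hasFDerivAt_integral_of_dominated_of_fderiv_le (𝕜 := ℂ) (bound := bound)
    (F' := fun z x => f x • fourierKernel x z • (-Complex.I • innerSL ℂ (toComplex x)))
    (Metric.ball_mem_nhds z₀ one_pos) (.of_forall hmeas) ?_ ?_ (.of_forall fun x z hz => ?_)
    (hint.const_mul _) (.of_forall fun x z _ =>
      (hasFDerivAt_fourierKernel x z).mul_const (f x))).differentiableAt
  · refine (hint.const_mul _).mono' (hmeas z₀) (.of_forall fun x => le_trans ?_
      (hbound (Metric.mem_ball_self one_pos) x))
    rw [norm_mul]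
    gcongr
    exact le_mul_of_one_le_right (norm_nonneg _) (le_add_of_nonneg_right (norm_nonneg x))
  · exact hf.smul (Continuous.aestronglyMeasurable (by
      have := continuous_fourierKernel z₀
      fun_prop))
  · refine le_trans ?_ (hbound hz x)
    calc ‖f x • fourierKernel x z • (-Complex.I • innerSL ℂ (toComplex x))‖
        = ‖fourierKernel x z‖ * ‖x‖ * ‖f x‖ := by
          simp only [norm_smul, norm_neg, Complex.norm_I, one_mul, innerSL_apply_norm,
            norm_toComplex]
          ring
      _ ≤ ‖fourierKernel x z‖ * (1 + ‖x‖) * ‖f x‖ := by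
          gcongr
          linarith

end FourierExt

/-! ### From complex multiples of real vectors to `ℂⁿ` -/

section ComplexDirections

variable {n : ℕ}

theorem exists_add_smul_conj_eq_smul_toComplex (ζ : EuclideanSpace ℂ (Fin n)) {p : ℂ}
    (hp : ‖p‖ = 1) :
    ∃ (w : ℂ) (x : EuclideanSpace ℝ (Fin n)), ζ + p • WithLp.toLp 2 (star ζ.ofLp) =
      w • toComplex x := by
  -- If `p = w²` with `|w| = 1`, then `ζ + p ζ̄ = w (w̄ ζ + w ζ̄)` and the bracket is real.
  obtain ⟨w, rfl⟩ := IsAlgClosed.exists_pow_nat_eq p two_pos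
  have hw : ‖w‖ = 1 := (pow_eq_one_iff_of_nonneg (norm_nonneg w) two_ne_zero).1
    (by rwa [norm_pow] at hp)
  have hww : w * (starRingEnd ℂ) w = 1 := by simp [Complex.mul_conj', hw]
  refine ⟨w, WithLp.toLp 2 fun j => 2 * ((starRingEnd ℂ) w * ζ j).re, ?_⟩
  ext j
  have hre := Complex.add_conj ((starRingEnd ℂ) w * ζ j)
  rw [map_mul, Complex.conj_conj] at hre
  simp only [PiLp.add_apply, PiLp.smul_apply, smul_eq_mul, toComplex_apply, Pi.star_apply]
  rw [← hre, ← starRingEnd_apply]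
  linear_combination (-(ζ j)) * hww

theorem norm_le_of_forall_smul_toComplex {E : Type*} [NormedAddCommGroup E] [NormedSpace ℂ E]
    {F : EuclideanSpace ℂ (Fin n) → E} (hF : Differentiable ℂ F) {ε C : ℝ} (hε : 0 ≤ ε)
    (hbound : ∀ (w : ℂ) (x : EuclideanSpace ℝ (Fin n)),
      ‖F (w • toComplex x)‖ ≤ C * Real.exp (ε * ‖w • toComplex x‖ ^ 2))
    (ζ : EuclideanSpace ℂ (Fin n)) : ‖F ζ‖ ≤ C * Real.exp (4 * ε * ‖ζ‖ ^ 2) := by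
  have hC : 0 ≤ C := nonneg_of_mul_nonneg_left ((norm_nonneg _).trans (hbound 0 0)) (Real.exp_pos _)
  -- Apply the maximum principle to `p ↦ F (ζ + p ζ̄)` on the unit disc.
  let ζbar : EuclideanSpace ℂ (Fin n) := WithLp.toLp 2 (star ζ.ofLp)
  have hnorm : ‖ζbar‖ = ‖ζ‖ := by simp [EuclideanSpace.norm_eq, ζbar]
  have hdiff : Differentiable ℂ fun p : ℂ => F (ζ + p • ζbar) :=
    hF.comp ((differentiable_id.smul_const ζbar).const_add ζ)
  suffices hcircle : ∀ p : ℂ, ‖p‖ = 1 →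
      ‖F (ζ + p • ζbar)‖ ≤ C * Real.exp (4 * ε * ‖ζ‖ ^ 2) by
    simpa using Complex.norm_le_of_forall_mem_frontier_norm_le
      (Metric.isBounded_ball (x := (0 : ℂ)) (r := 1)) hdiff.diffContOnCl
      (fun p hp => hcircle p (by simpa [frontier_ball] using hp))
      (subset_closure (Metric.mem_ball_self one_pos))
  intro p hp
  have hle : ‖ζ + p • ζbar‖ ≤ 2 * ‖ζ‖ := by
    refine (norm_add_le _ _).trans_eq ?_
    rw [norm_smul, hp, hnorm, one_mul, two_mul]
  obtain ⟨w, x, hwx⟩ := exists_add_smul_conj_eq_smul_toComplex ζ hp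
  calc ‖F (ζ + p • ζbar)‖ ≤ C * Real.exp (ε * ‖ζ + p • ζbar‖ ^ 2) := by
        rw [hwx]
        exact hbound w x
    _ ≤ C * Real.exp (ε * (2 * ‖ζ‖) ^ 2) := by gcongr
    _ = C * Real.exp (4 * ε * ‖ζ‖ ^ 2) := by ring_nf

end ComplexDirections

/-! ### Hardy's theorem -/

section Hardy

variable {n : ℕ} {a b : ℝ} {f : EuclideanSpace ℝ (Fin n) → ℂ}

theorem HasGaussianDecay.differentiable_fourierExt (ha : 0 < a) (hint : Integrable f)
    (hf : HasGaussianDecay a f) : Differentiable ℂ (fourierExt f) :=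
  Pfannschmidt.differentiable_fourierExt hint.aestronglyMeasurable (half_pos ha)
    (hf.integrable_exp_mul hint (half_lt_self ha))

theorem HasGaussianDecay.continuous_fourier (ha : 0 < a) (hint : Integrable f)
    (hf : HasGaussianDecay a f) : Continuous (fourier f) := by
  rw [← funext (fourierExt_toComplex f)]
  exact (hf.differentiable_fourierExt ha hint).continuous.comp continuous_toComplex

theorem norm_cexp_mul_sq_smul_toComplex (m : ℝ) (w : ℂ) (y : EuclideanSpace ℝ (Fin n)) :
    ‖Complex.exp (m * sq (w • toComplex y) / 2)‖ =
      Real.exp (m * (w.re ^ 2 - w.im ^ 2) * ‖y‖ ^ 2 / 2) := by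
  rw [sq_smul_toComplex, Complex.norm_exp]
  congr 1
  have hfactor : (m : ℂ) * (w ^ 2 * (‖y‖ ^ 2 : ℝ)) / 2 = ((m * ‖y‖ ^ 2 / 2 : ℝ) : ℂ) * w ^ 2 := by
    push_cast
    ring
  rw [hfactor, Complex.re_ofReal_mul, pow_two w, Complex.mul_re]
  ring

theorem HasGaussianDecay.exists_norm_fourierExt_mul_cexp_le (ha : 0 < a) (hint : Integrable f)
    (hf : HasGaussianDecay a f) (hfourier : HasGaussianDecay b (fourier f)) {a' b' : ℝ}
    (ha' : 0 < a') (ha'a : a' < a) (hb' : b' < b) (m : ℝ) :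
    ∃ C, ∀ y : EuclideanSpace ℝ (Fin n),
      (∀ w : ℂ, ‖fourierExt f (w • toComplex y) * Complex.exp (m * sq (w • toComplex y) / 2)‖ ≤
        C * Real.exp ((m * w.re ^ 2 + (a'⁻¹ - m) * w.im ^ 2) * ‖y‖ ^ 2 / 2)) ∧
      ∀ u : ℝ, ‖fourierExt f ((u : ℂ) • toComplex y) *
          Complex.exp (m * sq ((u : ℂ) • toComplex y) / 2)‖ ≤
        C * Real.exp ((m - b') * u ^ 2 * ‖y‖ ^ 2 / 2) := by
  obtain ⟨B, hB⟩ : ∃ B, ∀ (w : ℂ) y, ‖fourierExt f (w • toComplex y)‖ ≤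
      B * Real.exp (w.im ^ 2 * ‖y‖ ^ 2 / (2 * a')) :=
    ⟨_, norm_fourierExt_smul_toComplex_le ha' (hf.integrable_exp_mul hint ha'a)⟩
  obtain ⟨C, hC⟩ := hfourier.exists_norm_le (hf.continuous_fourier ha hint) hb'
  refine ⟨max B C, fun y => ⟨fun w => ?_, fun u => ?_⟩⟩
  · calc _ = ‖fourierExt f (w • toComplex y)‖ *
          Real.exp (m * (w.re ^ 2 - w.im ^ 2) * ‖y‖ ^ 2 / 2) := by
          rw [norm_mul, norm_cexp_mul_sq_smul_toComplex]
      _ ≤ max B C * Real.exp (w.im ^ 2 * ‖y‖ ^ 2 / (2 * a')) *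
          Real.exp (m * (w.re ^ 2 - w.im ^ 2) * ‖y‖ ^ 2 / 2) := by
          gcongr
          exact (hB w y).trans (by gcongr; exact le_max_left B C)
      _ = _ := by
          rw [mul_assoc, ← Real.exp_add]
          congr 2
          field_simp
          ring
  · calc _ = ‖fourier f (u • y)‖ * Real.exp (m * u ^ 2 * ‖y‖ ^ 2 / 2) := by
          rw [norm_mul, norm_cexp_mul_sq_smul_toComplex, ofReal_smul_toComplex,
            fourierExt_toComplex]
          simp
      _ ≤ max B C * Real.exp (-(b' * ‖u • y‖ ^ 2 / 2)) *
          Real.exp (m * u ^ 2 * ‖y‖ ^ 2 / 2) := by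
          gcongr
          exact (hC _).trans (by gcongr; exact le_max_right B C)
      _ = _ := by
          rw [mul_assoc, ← Real.exp_add, norm_smul, Real.norm_eq_abs, mul_pow, sq_abs]
          ring_nf

theorem differentiable_fourierExt_mul_cexp (hf : Differentiable ℂ (fourierExt f)) (m : ℂ) :
    Differentiable ℂ fun z => fourierExt f z * Complex.exp (m * sq z / 2) := by
  unfold sq
  fun_prop

theorem HasGaussianDecay.exists_norm_fourierExt_mul_cexp_le_exp (ha : 0 < a) (hab : a * b = 1)
    (hint : Integrable f) (hf : HasGaussianDecay a f) (hfourier : HasGaussianDecay b (fourier f))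
    {t : ℝ} (ht₀ : 0 < t) (ht₁ : t < 1) :
    ∃ C, ∀ z, ‖fourierExt f z * Complex.exp (b * sq z / 2)‖ ≤
      C * Real.exp (4 * (b * t) * ‖z‖ ^ 2) := by
  have hb : 0 < b := pos_of_mul_pos_right (hab ▸ one_pos) ha.le
  have hdiff := differentiable_fourierExt_mul_cexp (hf.differentiable_fourierExt ha hint) b
  have ha' : (b * (1 + t ^ 2))⁻¹ < a := by
    rw [eq_inv_of_mul_eq_one_left hab]
    exact inv_strictAnti₀ hb (lt_mul_of_one_lt_right hb (lt_add_of_pos_right 1 (pow_pos ht₀ 2)))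
  have hb' : b * (1 - t ^ 2) < b := mul_lt_of_lt_one_right hb (sub_lt_self 1 (pow_pos ht₀ 2))
  obtain ⟨C, hC⟩ :=
    hf.exists_norm_fourierExt_mul_cexp_le ha hint hfourier (by positivity) ha' hb' b
  refine ⟨C, norm_le_of_forall_smul_toComplex hdiff (by positivity) fun w y => ?_⟩
  obtain ⟨hgrowth, hreal⟩ := hC y
  refine (norm_le_exp_of_real_axis (C := C) (K := b * ‖y‖ ^ 2 / 2) (by positivity) ht₀ ht₁
    (hdiff.comp (differentiable_id.smul_const (toComplex y)))
    (fun w => (hgrowth w).trans_eq ?_) (fun u => (hreal u).trans_eq ?_) w).trans_eq ?_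
  · rw [inv_inv]
    ring_nf
  · ring_nf
  · rw [norm_smul, norm_toComplex]
    ring_nf

theorem HasGaussianDecay.isEntireMinimalType_fourierExt_mul_cexp (ha : 0 < a) (hab : a * b = 1)
    (hint : Integrable f) (hf : HasGaussianDecay a f) (hfourier : HasGaussianDecay b (fourier f)) :
    IsEntireMinimalType fun z => fourierExt f z * Complex.exp (b * sq z / 2) := by
  have hb : 0 < b := pos_of_mul_pos_right (hab ▸ one_pos) ha.le
  refine HasGaussianDecay.isEntireMinimalType (fun ε hε => ?_)
    (differentiable_fourierExt_mul_cexp (hf.differentiable_fourierExt ha hint) b)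
  obtain ⟨t, ht₀, ht⟩ := exists_between
    (lt_min one_pos (div_pos (neg_pos.2 hε) (by positivity : 0 < 8 * b)))
  obtain ⟨C, hC⟩ := hf.exists_norm_fourierExt_mul_cexp_le_exp ha hab hint hfourier ht₀
    (ht.trans_le (min_le_left _ _))
  have hC₀ : 0 ≤ C := nonneg_of_mul_nonneg_left ((norm_nonneg _).trans (hC 0)) (Real.exp_pos _)
  have hbt : t * (8 * b) ≤ -ε :=
    (le_div_iff₀ (by positivity)).1 (ht.le.trans (min_le_right _ _))
  refine .of_bound C (.of_forall fun z => (hC z).trans ?_)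
  rw [Real.norm_of_nonneg (Real.exp_pos _).le]
  gcongr
  nlinarith [mul_le_mul_of_nonneg_right hbt (sq_nonneg ‖z‖)]

theorem eq_zero_of_norm_le_mul_exp {k : ℂ → ℂ} (hk : Differentiable ℂ k) {K δ C : ℝ} (hK : 0 ≤ K)
    (hδ : 0 < δ) (hgrowth : ∀ w : ℂ, ‖k w‖ ≤ C * Real.exp (K * w.re ^ 2))
    (hreal : ∀ u : ℝ, ‖k u‖ ≤ C * Real.exp (-(δ * u ^ 2))) (w : ℂ) : k w = 0 := by
  have hC : 0 ≤ C := nonneg_of_mul_nonneg_left ((norm_nonneg _).trans (hreal 0)) (Real.exp_pos _)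
  have hbounded : ∀ w, ‖k w‖ ≤ C := norm_le_of_real_axis hK hk hgrowth fun u =>
    (hreal u).trans (mul_le_of_le_one_right hC (Real.exp_le_one_iff.2 (by
      rw [neg_nonpos]
      positivity)))
  have hconst (u : ℝ) : k u = k w := hk.apply_eq_apply_of_bounded
    (isBounded_iff_forall_norm_le.2 ⟨C, Set.forall_mem_range.2 hbounded⟩) u w
  have hlim : Tendsto (fun u : ℝ => C * Real.exp (-(δ * u ^ 2))) atTop (nhds 0) := by
    simpa using (Real.tendsto_exp_neg_atTop_nhds_zero.comp
      ((tendsto_pow_atTop two_ne_zero).const_mul_atTop hδ)).const_mul C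
  refine norm_le_zero_iff.1 (ge_of_tendsto' hlim fun u => ?_)
  exact hconst u ▸ hreal u

theorem HasGaussianDecay.fourier_eq_zero (ha : 0 < a) (hab : 1 < a * b) (hint : Integrable f)
    (hf : HasGaussianDecay a f) (hfourier : HasGaussianDecay b (fourier f))
    {ξ : EuclideanSpace ℝ (Fin n)} (hξ : ξ ≠ 0) : fourier f ξ = 0 := by
  obtain ⟨m, ham, hmb⟩ := exists_between ((inv_lt_iff_one_lt_mul₀' ha).2 hab)
  obtain ⟨b', hmb', hb'b⟩ := exists_between hmb
  have hm : 0 < m := (inv_pos.2 ha).trans ham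
  obtain ⟨C, hC⟩ := hf.exists_norm_fourierExt_mul_cexp_le ha hint hfourier (a' := m⁻¹)
    (inv_pos.2 hm) (inv_lt_of_inv_lt₀ ha ham) hb'b m
  obtain ⟨hgrowth, hreal⟩ := hC ξ
  have hzero := eq_zero_of_norm_le_mul_exp (K := m * ‖ξ‖ ^ 2 / 2) (δ := (b' - m) * ‖ξ‖ ^ 2 / 2)
    ((differentiable_fourierExt_mul_cexp (hf.differentiable_fourierExt ha hint) m).comp
      (differentiable_id.smul_const (toComplex ξ))) (by positivity)
    (by have := sub_pos.2 hmb'; have := norm_pos_iff.2 hξ; positivity)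
    (fun w => (hgrowth w).trans_eq (by rw [inv_inv]; ring_nf))
    (fun u => (hreal u).trans_eq (by ring_nf)) 1
  simpa [fourierExt_toComplex, Complex.exp_ne_zero] using hzero

end Hardy

section Inversion

variable {n : ℕ} {a b : ℝ} {f : EuclideanSpace ℝ (Fin n) → ℂ}

theorem HasGaussianDecay.ae_eq_zero [NeZero n] (ha : 0 < a) (hab : 1 < a * b) (hint : Integrable f)
    (hf : HasGaussianDecay a f) (hfourier : HasGaussianDecay b (fourier f)) : f =ᵐ[volume] 0 := by
  have hcont := hf.continuous_fourier ha hint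
  have hzero : fourier f = 0 := (Continuous.ext_on (dense_compl_singleton 0) hcont
    continuous_zero fun ξ hξ => hf.fourier_eq_zero ha hab hint hfourier hξ)
  filter_upwards [ae_eq_fourier_fourier_neg hint (hzero ▸ integrable_zero _ _ _)] with x hx
  rw [hx, hzero]
  simp [fourier]

theorem HasGaussianDecay.exists_isEntireMinimalType_fourier (ha : 0 < a) (hab : a * b = 1)
    (hint : Integrable f) (hf : HasGaussianDecay a f) (hfourier : HasGaussianDecay b (fourier f)) :
    ∃ G S : EuclideanSpace ℂ (Fin n) → ℂ, Differentiable ℂ G ∧ IsEntireMinimalType S ∧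
      (∀ ξ, fourier f ξ = G (toComplex ξ)) ∧
      ∀ z, G z = S z * Complex.exp (-(b * sq z / 2)) :=
  ⟨fourierExt f, fun z => fourierExt f z * Complex.exp (b * sq z / 2),
    hf.differentiable_fourierExt ha hint,
    hf.isEntireMinimalType_fourierExt_mul_cexp ha hab hint hfourier,
    fun ξ => (fourierExt_toComplex f ξ).symm,
    fun z => by simp [mul_assoc, ← Complex.exp_add]⟩

theorem HasGaussianDecay.exists_isEntireMinimalType_ae (ha : 0 < a) (hab : a * b = 1)
    (hint : Integrable f) (hf : HasGaussianDecay a f) (hfourier : HasGaussianDecay b (fourier f)) :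
    ∃ F R : EuclideanSpace ℂ (Fin n) → ℂ, Differentiable ℂ F ∧ IsEntireMinimalType R ∧
      (∀ᵐ x, f x = F (toComplex x)) ∧
      ∀ z, F z = R z * Complex.exp (-(a * sq z / 2)) := by
  have hb : 0 < b := pos_of_mul_pos_right (hab ▸ one_pos) ha.le
  have hcont := hf.continuous_fourier ha hint
  have hint' : Integrable (fourier f) := hfourier.integrable hb hcont.locallyIntegrable
  -- By Fourier inversion `f` is the Fourier transform of `g`, so the roles of `a` and `b` swap.
  let g := fun ξ => fourier f (-ξ)
  have hg_int : Integrable g := hint'.comp_neg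
  have hg : HasGaussianDecay b g := by
    simpa [g] using hfourier.comp_smul (c := (-1 : ℝ)) (by norm_num)
  have hfg : f =ᵐ[volume] fourier g := ae_eq_fourier_fourier_neg hint hint'
  obtain ⟨F, R, hF, hR, hFg, hFR⟩ := hg.exists_isEntireMinimalType_fourier hb
    (mul_comm a b ▸ hab) hg_int (hf.congr_ae hfg (hg.continuous_fourier hb hg_int))
  exact ⟨F, R, hF, hR, hfg.mono fun x hx => hx.trans (hFg x), hFR⟩

end Inversion

/-! ### Gaussians -/

section Gaussian

variable {n : ℕ}

theorem linearIndependent_gaussian (E : Type*) [NormedAddCommGroup E] [NormedSpace ℝ E]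
    [Nontrivial E] :
    LinearIndependent ℂ fun (c : ℝ) (x : E) => (Real.exp (-(c * ‖x‖ ^ 2 / 2)) : ℂ) := by
  -- Restricted to points with `‖x‖² = m ∈ ℕ`, these functions become distinct characters of `ℕ`.
  choose x hx using fun m : ℕ => exists_norm_eq E (Real.sqrt_nonneg m)
  let χ (c : ℝ) : Multiplicative ℕ →* ℂ := powersHom ℂ (Real.exp (-(c / 2)) : ℂ)
  have hχ : Function.Injective χ := fun c d hcd => by
    simpa [-Complex.ofReal_exp] using (powersHom ℂ).injective hcd
  refine .of_comp (LinearMap.funLeft ℂ ℂ fun m : Multiplicative ℕ => x m.toAdd) ?_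
  suffices hcomp : (LinearMap.funLeft ℂ ℂ fun m : Multiplicative ℕ => x m.toAdd) ∘
      (fun (c : ℝ) (x : E) => (Real.exp (-(c * ‖x‖ ^ 2 / 2)) : ℂ)) = fun c => ⇑(χ c) by
    rw [hcomp]
    exact (linearIndependent_monoidHom (Multiplicative ℕ) ℂ).comp χ hχ
  ext c m
  simp only [Function.comp_apply, LinearMap.funLeft_apply, χ, powersHom_apply, hx,
    Real.sq_sqrt (Nat.cast_nonneg _)]
  rw [← Complex.ofReal_pow, ← Real.exp_nat_mul]
  ring_nf

theorem fourier_gaussian {c : ℝ} (hc : 0 < c) (ξ : EuclideanSpace ℝ (Fin n)) :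
    fourier (fun x => (Real.exp (-(c * ‖x‖ ^ 2 / 2)) : ℂ)) ξ =
      (c ^ (-(n : ℝ) / 2) : ℝ) * Real.exp (-(c⁻¹ * ‖ξ‖ ^ 2 / 2)) := by
  have hgauss : (fun x : EuclideanSpace ℝ (Fin n) => (Real.exp (-(c * ‖x‖ ^ 2 / 2)) : ℂ)) =
      fun x => Complex.exp (-((c / 2 : ℝ) : ℂ) * (‖x‖ : ℂ) ^ 2) := by
    ext x
    push_cast
    ring_nf
  have hpow : (2 * Real.pi) ^ (-(n : ℝ) / 2) * (Real.pi / (c / 2)) ^ ((n : ℝ) / 2) =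
      c ^ (-(n : ℝ) / 2) := by
    have hdiv : Real.pi / (c / 2) = 2 * Real.pi / c := by field_simp
    rw [hdiv, Real.div_rpow (by positivity) hc.le, neg_div, Real.rpow_neg (by positivity),
      Real.rpow_neg hc.le]
    field_simp
  have hexp : -(Real.pi : ℂ) ^ 2 * (‖(2 * Real.pi)⁻¹ • ξ‖ : ℂ) ^ 2 / ((c / 2 : ℝ) : ℂ) =
      ((-(c⁻¹ * ‖ξ‖ ^ 2 / 2) : ℝ) : ℂ) := by
    rw [norm_smul, Real.norm_of_nonneg (by positivity)]
    have hpi : (Real.pi : ℂ) ≠ 0 := by exact_mod_cast Real.pi_ne_zero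
    have hc' : (c : ℂ) ≠ 0 := by exact_mod_cast hc.ne'
    push_cast
    field_simp
  rw [hgauss, fourier_eq_mul_fourierTransform,
    fourier_gaussian_innerProductSpace (by simpa using hc), hexp, ← Complex.ofReal_exp,
    finrank_euclideanSpace_fin, ← Complex.ofReal_div, ← Complex.ofReal_natCast,
    ← Complex.ofReal_ofNat, ← Complex.ofReal_div, ← Complex.ofReal_cpow (by positivity),
    ← mul_assoc, ← Complex.ofReal_mul, hpow]

theorem condition_gaussian [NeZero n] {a b c : ℝ} (ha : 0 < a) (hac : a ≤ c) (hbc : b * c ≤ 1) :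
    Condition a b (fun _ : EuclideanSpace ℝ (Fin n) => 1) (fun _ => 1 + a ^ (-(n : ℝ) / 2))
      fun x => (Real.exp (-(c * ‖x‖ ^ 2 / 2)) : ℂ) := by
  have hc : 0 < c := ha.trans_le hac
  refine ⟨(integrable_exp_neg_mul_norm_sq hc).ofReal, fun x => ?_, fun ξ => ?_,
    (hasGaussianDecay_const 1).logGrowth_eq_zero fun _ => le_rfl,
    (hasGaussianDecay_const _).logGrowth_eq_zero fun _ => ?_⟩
  · rw [Complex.norm_real, Real.norm_of_nonneg (Real.exp_pos _).le, one_mul]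
    gcongr
  · rw [fourier_gaussian hc, norm_mul, Complex.norm_real, Complex.norm_real,
      Real.norm_of_nonneg (by positivity), Real.norm_of_nonneg (Real.exp_pos _).le]
    have hpow : c ^ (-(n : ℝ) / 2) ≤ a ^ (-(n : ℝ) / 2) :=
      Real.rpow_le_rpow_of_nonpos ha hac (by rw [neg_div, neg_nonpos]; positivity)
    have hbc' : b ≤ c⁻¹ := by rwa [← one_div, le_div_iff₀ hc]
    gcongr
    linarith
  · exact le_add_of_nonneg_right (by positivity)

theorem exists_linearIndependent_condition [NeZero n] {a b : ℝ} (ha : 0 < a) (hb : 0 < b)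
    (hab : a * b < 1) :
    ∃ (P Q : EuclideanSpace ℝ (Fin n) → ℝ) (g : ℕ → EuclideanSpace ℝ (Fin n) → ℂ),
      LinearIndependent ℂ g ∧ ∀ k, Continuous (g k) ∧ Condition a b P Q (g k) := by
  have hlt : a < b⁻¹ := by rwa [← one_div, lt_div_iff₀ hb]
  let c := (Set.Ioo_infinite hlt).natEmbedding
  refine ⟨fun _ => 1, fun _ => 1 + a ^ (-(n : ℝ) / 2), _,
    (linearIndependent_gaussian (EuclideanSpace ℝ (Fin n))).comp (fun k => (c k : ℝ))
      (Subtype.val_injective.comp c.injective), fun k => ⟨?_, ?_⟩⟩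
  · fun_prop
  · refine condition_gaussian ha (c k).2.1.le ?_
    exact (le_inv_mul_iff₀ hb).1 (by simpa using (c k).2.2.le)

end Gaussian

/-! ### Hermite functions -/

section Hermite

open scoped FourierTransform

/-- The Hermite function `e^(t²/2) (d/dt)^k e^(-t²)` without its normalizing constant, so that
raising the index is the operator `d/dt - t`. -/
noncomputable def unnormalizedHermite (k : ℕ) (t : ℝ) : ℂ :=
  (Real.exp (t ^ 2 / 2) * iteratedDeriv k (fun s : ℝ => Real.exp (-s ^ 2)) t : ℝ)

theorem unnormalizedHermite_eq_eval_mul (k : ℕ) (t : ℝ) : unnormalizedHermite k t =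
    ((-√2) ^ k * Polynomial.aeval (√2 * t) (Polynomial.hermite k) * Real.exp (-(1 * ‖t‖ ^ 2 / 2)) :
      ℝ) := by
  have hcomp : (fun s : ℝ => Real.exp (-s ^ 2)) = fun s => Real.exp (-((√2 * s) ^ 2 / 2)) := by
    simp [mul_pow]
  rw [unnormalizedHermite, hcomp,
    iteratedDeriv_comp_const_mul (f := fun y => Real.exp (-(y ^ 2 / 2))) (by fun_prop),
    iteratedDeriv_eq_iterate]
  simp only [Polynomial.deriv_gaussian_eq_hermite_mul_gaussian]
  have hexp : Real.exp (t ^ 2 / 2) * Real.exp (-((√2 * t) ^ 2 / 2)) =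
      Real.exp (-(1 * ‖t‖ ^ 2 / 2)) := by
    rw [← Real.exp_add, mul_pow, Real.sq_sqrt zero_le_two, Real.norm_eq_abs, sq_abs]
    ring_nf
  rw [← hexp, neg_pow √2]
  congr 1
  ring

theorem hasGaussianDecay_id (E : Type*) [NormedAddCommGroup E] :
    HasGaussianDecay 0 fun x : E => x := by
  intro a' ha'
  obtain ⟨c, hc, rfl⟩ : ∃ c > 0, a' = -(2 * c) := ⟨-a' / 2, by linarith, by ring⟩
  refine .of_bound (1 + c⁻¹) (.of_forall fun x => ?_)
  calc ‖x‖ ≤ 1 + ‖x‖ ^ 2 := by nlinarith only [sq_nonneg (‖x‖ - 1)]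
    _ ≤ 1 + ‖x‖ ^ 2 + (c * ‖x‖ ^ 2 + c⁻¹) := le_add_of_nonneg_right (by positivity)
    _ = (1 + c⁻¹) * (c * ‖x‖ ^ 2 + 1) := by field_simp; ring
    _ ≤ (1 + c⁻¹) * Real.exp (c * ‖x‖ ^ 2) := by
      gcongr
      exact Real.add_one_le_exp _
    _ = (1 + c⁻¹) * ‖Real.exp (-(-(2 * c) * ‖x‖ ^ 2 / 2))‖ := by
      rw [Real.norm_of_nonneg (Real.exp_pos _).le]
      ring_nf

theorem HasGaussianDecay.ofReal {E : Type*} [NormedAddCommGroup E] {a : ℝ} {f : E → ℝ}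
    (hf : HasGaussianDecay a f) : HasGaussianDecay a fun x => (f x : ℂ) :=
  fun a' ha' => Complex.isBigO_ofReal_left.2 (hf a' ha')

theorem HasGaussianDecay.polynomial_aeval {E S R : Type*} [NormedAddCommGroup E] [CommSemiring S]
    [NormedRing R] [Algebra S R] {g : E → R} (hg : HasGaussianDecay 0 g) (p : Polynomial S) :
    HasGaussianDecay 0 fun x => Polynomial.aeval (g x) p := by
  induction p using Polynomial.induction_on with
  | C r => simpa using hasGaussianDecay_const (algebraMap S R r)
  | add p q hp hq => simpa using hp.add hq
  | monomial k r hk => simpa [pow_succ, mul_assoc] using hk.mul hg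

theorem continuous_unnormalizedHermite (k : ℕ) : Continuous (unnormalizedHermite k) := by
  rw [funext (unnormalizedHermite_eq_eval_mul k)]
  fun_prop

theorem hasGaussianDecay_unnormalizedHermite (k : ℕ) :
    HasGaussianDecay 1 (unnormalizedHermite k) := by
  have hpoly := (((hasGaussianDecay_id ℝ).const_mul √2).polynomial_aeval
    (Polynomial.hermite k)).const_mul ((-√2) ^ k)
  have hreal := (hpoly.mul (hasGaussianDecay_exp 1)).ofReal
  rw [zero_add] at hreal
  rwa [funext (unnormalizedHermite_eq_eval_mul k)]

theorem hasDerivAt_unnormalizedHermite (k : ℕ) (t : ℝ) :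
    HasDerivAt (unnormalizedHermite k)
      (t * unnormalizedHermite k t + unnormalizedHermite (k + 1) t) t := by
  have hsmooth : ContDiff ℝ (k + 1) fun s : ℝ => Real.exp (-s ^ 2) := by fun_prop
  have hiter : HasDerivAt (iteratedDeriv k fun s : ℝ => Real.exp (-s ^ 2))
      (iteratedDeriv (k + 1) (fun s : ℝ => Real.exp (-s ^ 2)) t) t := by
    rw [iteratedDeriv_succ]
    exact (hsmooth.differentiable_iteratedDeriv k (by exact_mod_cast k.lt_succ_self) t).hasDerivAt
  have hexp : HasDerivAt (fun s : ℝ => Real.exp (s ^ 2 / 2)) (Real.exp (t ^ 2 / 2) * t) t := by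
    simpa using ((hasDerivAt_pow 2 t).div_const 2).exp
  refine (hexp.mul hiter).ofReal_comp.congr_deriv ?_
  rw [unnormalizedHermite, unnormalizedHermite]
  push_cast
  ring

theorem fourierTransform_const_mul {V : Type*} [NormedAddCommGroup V] [InnerProductSpace ℝ V]
    [FiniteDimensional ℝ V] [MeasurableSpace V] [BorelSpace V] (c : ℂ) (f : V → ℂ) (ξ : V) :
    𝓕 (fun x => c * f x) ξ = c * 𝓕 f ξ :=
  congrFun (VectorFourier.fourierIntegral_const_smul Real.fourierChar volume (innerₗ V) f c) ξ

theorem fourierTransform_deriv_sub_two_pi_mul {f : ℝ → ℂ} (hdiff : Differentiable ℝ f)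
    (hf : Integrable f) (hderiv : Integrable (deriv f)) (hmul : Integrable fun t : ℝ => t * f t)
    (ξ : ℝ) :
    𝓕 (fun t : ℝ => deriv f t - 2 * Real.pi * t * f t) ξ =
      -Complex.I * (deriv (𝓕 f) ξ - 2 * Real.pi * ξ * 𝓕 f ξ) := by
  let g (t : ℝ) : ℂ := (-2 * Real.pi * Complex.I * t) • f t
  have hg : Integrable g := by
    refine (hmul.const_mul (-2 * Real.pi * Complex.I)).congr (.of_forall fun t => ?_)
    simp only [g, smul_eq_mul, mul_assoc]
  have hsplit : (fun t : ℝ => deriv f t - 2 * Real.pi * t * f t) =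
      deriv f + fun t => -Complex.I * g t := by
    ext t
    simp only [Pi.add_apply, g, smul_eq_mul]
    linear_combination (-2 * Real.pi * t * f t) * Complex.I_sq
  have hadd : 𝓕 (deriv f + fun t => -Complex.I * g t) =
      𝓕 (deriv f) + 𝓕 fun t => -Complex.I * g t :=
    VectorFourier.fourierIntegral_add Real.continuous_fourierChar continuous_inner hderiv
      (hg.const_mul _)
  rw [hsplit, hadd, Pi.add_apply, fourierTransform_const_mul, Real.fourier_deriv hf hdiff hderiv,
    ← Real.deriv_fourier hf (by simpa using hmul)]
  simp only [smul_eq_mul]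
  ring

theorem integrable_unnormalizedHermite_mul {c : ℝ} (hc : c ≠ 0) (k : ℕ) :
    Integrable fun t : ℝ => unnormalizedHermite k (c * t) :=
  ((hasGaussianDecay_unnormalizedHermite k).comp_smul hc).integrable (by positivity)
    ((continuous_unnormalizedHermite k).comp (continuous_const_mul c)).locallyIntegrable

theorem integrable_mul_unnormalizedHermite_mul {c : ℝ} (hc : c ≠ 0) (k : ℕ) :
    Integrable fun t : ℝ => t * unnormalizedHermite k (c * t) := by
  have hdecay := (hasGaussianDecay_id ℝ).ofReal.mul
    ((hasGaussianDecay_unnormalizedHermite k).comp_smul hc)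
  exact hdecay.integrable (by positivity) (Complex.continuous_ofReal.mul
    ((continuous_unnormalizedHermite k).comp (continuous_const_mul c))).locallyIntegrable

theorem deriv_unnormalizedHermite_mul (c : ℝ) (k : ℕ) (t : ℝ) :
    deriv (fun t : ℝ => unnormalizedHermite k (c * t)) t =
      c ^ 2 * (t * unnormalizedHermite k (c * t)) + c * unnormalizedHermite (k + 1) (c * t) := by
  have hderiv := (hasDerivAt_unnormalizedHermite k (c * t)).scomp t (hasDerivAt_const_mul c)
  refine hderiv.deriv.trans ?_
  rw [Complex.real_smul]
  push_cast
  ring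

theorem mul_fourierTransform_unnormalizedHermite_succ (k : ℕ) {c : ℝ} (hc : c ≠ 0)
    (hc_sq : c ^ 2 = 2 * Real.pi) (ξ : ℝ) :
    c * 𝓕 (fun t : ℝ => unnormalizedHermite (k + 1) (c * t)) ξ =
      -Complex.I * (deriv (𝓕 fun t : ℝ => unnormalizedHermite k (c * t)) ξ -
        2 * Real.pi * ξ * 𝓕 (fun t : ℝ => unnormalizedHermite k (c * t)) ξ) := by
  have hderiv := deriv_unnormalizedHermite_mul c k
  have hint : Integrable (deriv fun t : ℝ => unnormalizedHermite k (c * t)) := by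
    rw [funext hderiv]
    exact ((integrable_mul_unnormalizedHermite_mul hc k).const_mul _).add
      ((integrable_unnormalizedHermite_mul hc (k + 1)).const_mul _)
  have hdiff : Differentiable ℝ fun t : ℝ => unnormalizedHermite k (c * t) :=
    Differentiable.comp (g := unnormalizedHermite k)
      (fun t => (hasDerivAt_unnormalizedHermite k t).differentiableAt) (by fun_prop)
  have hraise : (fun t : ℝ => (c : ℂ) * unnormalizedHermite (k + 1) (c * t)) =
      fun t : ℝ => deriv (fun t : ℝ => unnormalizedHermite k (c * t)) t -
        2 * Real.pi * t * unnormalizedHermite k (c * t) := by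
    ext t
    have hc_sq' : (c : ℂ) ^ 2 = 2 * Real.pi := by exact_mod_cast hc_sq
    rw [hderiv, hc_sq']
    ring
  rw [← fourierTransform_const_mul, hraise]
  exact fourierTransform_deriv_sub_two_pi_mul hdiff (integrable_unnormalizedHermite_mul hc k) hint
    (integrable_mul_unnormalizedHermite_mul hc k) ξ

theorem fourierTransform_unnormalizedHermite (k : ℕ) :
    𝓕 (fun t : ℝ => unnormalizedHermite k (√(2 * Real.pi) * t)) =
      fun ξ => (-Complex.I) ^ k * unnormalizedHermite k (√(2 * Real.pi) * ξ) := by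
  have hc₀ : √(2 * Real.pi) ≠ 0 := (Real.sqrt_pos.2 Real.two_pi_pos).ne'
  have hc_sq : √(2 * Real.pi) ^ 2 = 2 * Real.pi := Real.sq_sqrt Real.two_pi_pos.le
  generalize √(2 * Real.pi) = c at *
  induction k with
  | zero =>
    have hzero : (fun t : ℝ => unnormalizedHermite 0 (c * t)) =
        fun t : ℝ => Complex.exp (-Real.pi * 1 * t ^ 2) := by
      ext t
      rw [unnormalizedHermite, iteratedDeriv_zero, ← Real.exp_add, mul_pow, hc_sq]
      push_cast
      ring_nf
    rw [hzero, fourier_gaussian_pi (by simp)]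
    simpa using hzero.symm
  | succ k ih =>
    ext ξ
    have hc_sq' : (c : ℂ) ^ 2 = 2 * Real.pi := by exact_mod_cast hc_sq
    refine mul_left_cancel₀ (Complex.ofReal_ne_zero.2 hc₀) ?_
    rw [mul_fourierTransform_unnormalizedHermite_succ k hc₀ hc_sq, ih, deriv_const_mul_field,
      deriv_unnormalizedHermite_mul, hc_sq']
    ring

theorem hermite1_eq_mul_unnormalizedHermite (k : ℕ) (t : ℝ) : (hermite1 k t : ℂ) =
    ((√(2 ^ k * (k.factorial : ℝ) * √Real.pi))⁻¹ * (-1) ^ k : ℝ) * unnormalizedHermite k t := by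
  rw [hermite1, unnormalizedHermite, ← Complex.ofReal_mul, mul_assoc]

theorem fourierTransform_hermite1 (k : ℕ) (ξ : ℝ) :
    𝓕 (fun t : ℝ => (hermite1 k (√(2 * Real.pi) * t) : ℂ)) ξ =
      (-Complex.I) ^ k * hermite1 k (√(2 * Real.pi) * ξ) := by
  simp only [hermite1_eq_mul_unnormalizedHermite, fourierTransform_const_mul,
    fourierTransform_unnormalizedHermite]
  ring

theorem fourierTransform_prod {ι : Type*} [Fintype ι] (h : ι → ℝ → ℂ) (ξ : EuclideanSpace ℝ ι) :
    𝓕 (fun x : EuclideanSpace ℝ ι => ∏ j, h j (x j)) ξ = ∏ j, 𝓕 (h j) (ξ j) := by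
  simp only [Real.fourier_eq', smul_eq_mul]
  rw [← integral_fintype_prod_volume_eq_prod,
    ← (PiLp.volume_preserving_toLp ι).integral_comp
      (MeasurableEquiv.toLp 2 _).measurableEmbedding]
  congr 1
  ext v
  rw [Finset.prod_mul_distrib, ← Complex.exp_sum]
  congr 2
  simp [PiLp.inner_apply, mul_comm, Finset.mul_sum]

theorem HasGaussianDecay.prod {ι R : Type*} [Fintype ι] [NormedCommRing R] [NormOneClass R]
    {a : ℝ} {h : ι → ℝ → R} (hh : ∀ j, HasGaussianDecay a (h j)) (hcont : ∀ j, Continuous (h j)) :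
    HasGaussianDecay a fun x : EuclideanSpace ℝ ι => ∏ j, h j (x j) := by
  intro a' ha'
  choose C hC using fun j => (hh j).exists_norm_le (hcont j) ha'
  refine .of_bound (∏ j, C j) (.of_forall fun x => ?_)
  calc ‖∏ j, h j (x j)‖ ≤ ∏ j, ‖h j (x j)‖ := Finset.norm_prod_le _ _
    _ ≤ ∏ j, C j * Real.exp (-(a' * ‖x j‖ ^ 2 / 2)) :=
      Finset.prod_le_prod (fun _ _ => norm_nonneg _) fun j _ => hC j (x j)
    _ = (∏ j, C j) * ‖Real.exp (-(a' * ‖x‖ ^ 2 / 2))‖ := by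
      rw [Finset.prod_mul_distrib, ← Real.exp_sum, Real.norm_of_nonneg (Real.exp_pos _).le,
        Finset.sum_neg_distrib, ← Finset.sum_div, ← Finset.mul_sum,
        EuclideanSpace.norm_sq_eq]

variable {n : ℕ}

theorem fourier_eq_fourierTransform_comp_smul (f : EuclideanSpace ℝ (Fin n) → ℂ)
    (ξ : EuclideanSpace ℝ (Fin n)) :
    fourier f ξ = 𝓕 (fun x => f (√(2 * Real.pi) • x)) ((√(2 * Real.pi))⁻¹ • ξ) := by
  rw [fourierTransform_comp_smul f (Real.sqrt_pos.2 Real.two_pi_pos).ne',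
    fourier_eq_mul_fourierTransform, smul_smul, ← mul_inv, Real.mul_self_sqrt Real.two_pi_pos.le,
    finrank_euclideanSpace_fin, Complex.real_smul]
  congr 2
  rw [abs_of_pos (by positivity), Real.sqrt_eq_rpow, ← Real.rpow_mul_natCast (by positivity),
    ← Real.rpow_neg (by positivity)]
  ring_nf

theorem hermiteFun_eq_prod (α : Fin n → ℕ) :
    hermiteFun α = fun x => ∏ j, (hermite1 (α j) (x j) : ℂ) :=
  funext fun _ => Complex.ofReal_prod _ _

theorem fourier_hermiteFun (α : Fin n → ℕ) (ξ : EuclideanSpace ℝ (Fin n)) :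
    fourier (hermiteFun α) ξ = (-Complex.I) ^ (∑ j, α j) * hermiteFun α ξ := by
  simp only [fourier_eq_fourierTransform_comp_smul, hermiteFun_eq_prod, PiLp.smul_apply,
    smul_eq_mul]
  rw [fourierTransform_prod fun j t => (hermite1 (α j) (√(2 * Real.pi) * t) : ℂ)]
  simp only [fourierTransform_hermite1, PiLp.smul_apply, smul_eq_mul,
    mul_inv_cancel_left₀ (Real.sqrt_pos.2 Real.two_pi_pos).ne', Finset.prod_mul_distrib,
    Finset.prod_pow_eq_pow_sum]

theorem continuous_ofReal_hermite1 (k : ℕ) : Continuous fun t => (hermite1 k t : ℂ) := by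
  simp only [hermite1_eq_mul_unnormalizedHermite]
  exact (continuous_unnormalizedHermite k).const_mul _

theorem hasGaussianDecay_hermite1 (k : ℕ) :
    HasGaussianDecay 1 fun t => (hermite1 k t : ℂ) := by
  simp only [hermite1_eq_mul_unnormalizedHermite]
  exact (hasGaussianDecay_unnormalizedHermite k).const_mul _

theorem hasGaussianDecay_hermiteFun (α : Fin n → ℕ) : HasGaussianDecay 1 (hermiteFun α) := by
  have hprod := HasGaussianDecay.prod (fun j => hasGaussianDecay_hermite1 (α j))
    fun j => continuous_ofReal_hermite1 (α j)
  rwa [hermiteFun_eq_prod]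

theorem continuous_hermiteFun (α : Fin n → ℕ) : Continuous (hermiteFun α) := by
  have hprod : Continuous fun x : EuclideanSpace ℝ (Fin n) => ∏ j, (hermite1 (α j) (x j) : ℂ) :=
    continuous_finsetProd _ fun j _ => (continuous_ofReal_hermite1 (α j)).comp (by fun_prop)
  rwa [hermiteFun_eq_prod]

theorem exists_condition_hermiteFun [NeZero n] {a b c : ℝ} (hc : 0 < c) (hac : a ≤ c ^ 2)
    (hbc : b * c ^ 2 ≤ 1) (α : Fin n → ℕ) :
    ∃ P Q : EuclideanSpace ℝ (Fin n) → ℝ, Condition a b P Q fun x => hermiteFun α (c • x) := by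
  have hdecay {c : ℝ} (hc : 0 < c) :
      HasGaussianDecay (c ^ 2) fun x : EuclideanSpace ℝ (Fin n) => hermiteFun α (c • x) := by
    simpa [abs_of_pos hc] using (hasGaussianDecay_hermiteFun α).comp_smul hc.ne'
  refine exists_condition_iff.2 ⟨?_, (hdecay hc).mono hac, ?_⟩
  · exact (hdecay hc).integrable (by positivity)
      ((continuous_hermiteFun α).comp (continuous_const_smul c)).locallyIntegrable
  · have hbc' : b ≤ c⁻¹ ^ 2 := by rwa [inv_pow, ← one_div, le_div_iff₀ (by positivity)]
    simp only [funext (fourier_comp_smul (hermiteFun α) hc.ne'), fourier_hermiteFun]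
    exact (((hdecay (inv_pos.2 hc)).mono hbc').const_mul _).const_mul _

end Hermite

end Pfannschmidt

theorem theorem1p3 (n : ℕ) (hn : 1 ≤ n) (a b : ℝ) (ha : 0 < a) (hb : 0 < b) :
    (∀ (f : EuclideanSpace ℝ (Fin n) → ℂ) (P Q : EuclideanSpace ℝ (Fin n) → ℝ),
      Pfannschmidt.Condition a b P Q f →
        (1 < a * b → f =ᵐ[volume] 0) ∧
        (a * b = 1 →
          ∃ F G R S : EuclideanSpace ℂ (Fin n) → ℂ,
            Differentiable ℂ F ∧ Differentiable ℂ G ∧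
            (∀ᵐ x, f x = F (Pfannschmidt.toComplex x)) ∧
            (∀ ξ, Pfannschmidt.fourier f ξ = G (Pfannschmidt.toComplex ξ)) ∧
            Pfannschmidt.IsEntireMinimalType R ∧ Pfannschmidt.IsEntireMinimalType S ∧
            (∀ z, F z = R z * Complex.exp (-((a : ℂ) * Pfannschmidt.sq z / 2))) ∧
            (∀ z, G z = S z * Complex.exp (-(Pfannschmidt.sq z / (2 * (a : ℂ))))))) ∧
    (a * b < 1 →
      (∃ (P Q : EuclideanSpace ℝ (Fin n) → ℝ) (g : ℕ → EuclideanSpace ℝ (Fin n) → ℂ),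
        LinearIndependent ℂ g ∧
        ∀ k, Continuous (g k) ∧ Pfannschmidt.Condition a b P Q (g k)) ∧
      ∀ c : ℝ, 0 < c → a ≤ c ^ 2 → b * c ^ 2 ≤ 1 → ∀ α : Fin n → ℕ,
        ∃ P Q : EuclideanSpace ℝ (Fin n) → ℝ,
          Pfannschmidt.Condition a b P Q (fun x => Pfannschmidt.hermiteFun α (c • x))) := by
  have : NeZero n := ⟨Nat.one_le_iff_ne_zero.1 hn⟩
  refine ⟨fun f P Q hf => ?_, fun hab => ⟨?_, fun c hc hac hbc α => ?_⟩⟩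
  · obtain ⟨hint, hdecay, hfourier⟩ := Pfannschmidt.exists_condition_iff.1 ⟨P, Q, hf⟩
    refine ⟨fun hab => hdecay.ae_eq_zero ha hab hint hfourier, fun hab => ?_⟩
    obtain ⟨F, R, hF, hR, hfF, hFR⟩ :=
      hdecay.exists_isEntireMinimalType_ae ha hab hint hfourier
    obtain ⟨G, S, hG, hS, hfG, hGS⟩ :=
      hdecay.exists_isEntireMinimalType_fourier ha hab hint hfourier
    have hb_mul (w : ℂ) : b * w / 2 = w / (2 * a) := by
      rw [eq_inv_of_mul_eq_one_right hab, Complex.ofReal_inv]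
      field_simp
    exact ⟨F, G, R, S, hF, hG, hfF, hfG, hR, hS, hFR, fun z => hb_mul (Pfannschmidt.sq z) ▸ hGS z⟩
  · exact Pfannschmidt.exists_linearIndependent_condition ha hb hab
  · exact Pfannschmidt.exists_condition_hermiteFun hc hac hbc α
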